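/- Let $\mathcal H$ be a finite-dimensional complex Hilbert space and let $U$ be a continuous unitary representation of a compact group $G$ on $\mathcal H$. Let $\mathcal V^G$ be the group of $G$-invariant unitaries (those commuting with all $U(g)$), and let $\mathcal{SV}^G=[\mathcal V^G,\mathcal V^G]$ be its commutator subgroup. Let $\mathrm{Irreps}_G$ be the finite set of inequivalent irreducible representations of $G$ occurring in $\mathcal H$; for $\lambda\in\mathrm{Irreps}_G$ let $\Pi_\lambda$ be the orthogonal projector onto the $\lambda$-isotypic component of $\mathcal H$ and $m_\lambda$ the multiplicity of $\lambda$ in $\mathcal H$. Let $\{H_l\}_l$ be a family of $G$-invariant Hermitian operators on $\mathcal H$ and let $\mathcal W^G\subseteq\mathcal V^G$ be the group generated by the one-parameter families $\{\exp(-iH_lt):t\in\mathbb R\}_l$. Assume that $\mathcal W^G$ is compact and semi-universal, i.e. $\mathcal W^G\supseteq\mathcal{SV}^G$. Let $t_{\max}\in\mathbb N\cup\{\infty\}$ be the largest integer $t\ge 0$ such that $$\mathbb E_{V\sim\mathcal W^G}\big[V^{\otimes t}\otimes (V^*)^{\otimes t}\big]=\mathbb E_{V\sim\mathcal V^G}\big[V^{\otimes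 t}\otimes (V^*)^{\otimes t}\big],$$ and $t_{\max}=\infty$ if this holds for all $t$; here the expectations are over the normalized Haar measures of $\mathcal W^G$ and $\mathcal V^G$, and $V^*$ is the complex conjugate of $V$ in a fixed orthonormal basis. For integers $q(\lambda)$, $\lambda\in\mathrm{Irreps}_G$, put $Q=\sum_\lambda q(\lambda)\,m_\lambda\,\Pi_\lambda/\operatorname{Tr}\Pi_\lambda$. Then, with $\|A\|_1=\operatorname{Tr}\sqrt{AA^\dagger}$, $\|Q\|_1=\sum_\lambda|q(\lambda)|m_\lambda$, $\operatorname{Tr}Q=\sum_\lambda q(\lambda)m_\lambda$ and $\operatorname{Tr}(H_lQ)=\sum_\lambda q(\lambda)m_\lambda\operatorname{Tr}(H_l\Pi_\lambda)/\operatorname{Tr}\Pi_\lambda$. Call $q$ admissible if $\|Q\|_1\ne0$, $\operatorname{Tr}Q=0$ and $\operatorname{Tr}(H_lQ)=0$ for all $l$. 1. If an admissible $q$ exists, then the minima below are attained, $t_{\max}$ is finite, and $$t_{\max}=\tfrac12\min_{q\text{ admissible}}\|Q\|_1-1=\tfrac12\min_{q\text{ admissible}}\sum_\lambda|q(\lambda)|m_\lambda-1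 .$$ 2. If no admissible $q$ exists, then $\mathcal W^G$ contains all $G$-invariant unitaries up to a global phase (for every $V\in\mathcal V^G$ there is $\theta\in\mathbb R$ with $e^{i\theta}V\in\mathcal W^G$), and $t_{\max}=\infty$. -/

import Mathlib

open scoped MonoidAlgebra Kronecker

noncomputable section

namespace SymDesign

section Group

variable {H : Type*} [NormedAddCommGroup H] [InnerProductSpace ℂ H] [FiniteDimensional ℂ H]
  [CompleteSpace H]

/-- The trace of an operator on `H`. -/
def opTrace (A : H →L[ℂ] H) : ℂ := LinearMap.trace ℂ H (A : H →ₗ[ℂ] H)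

/-- The trace norm `‖A‖₁ = Tr √(A A†)`. -/
def traceNorm (A : H →L[ℂ] H) : ℝ := (opTrace (CFC.sqrt (A * star A))).re

/-- The group of unitary operators on a finite-dimensional Hilbert space is compact. -/
instance compactSpace_unitary : CompactSpace (unitary (H →L[ℂ] H)) := by
  have : ProperSpace (H →L[ℂ] H) := FiniteDimensional.proper ℂ _
  refine isCompact_iff_compactSpace (s := (unitary (H →L[ℂ] H) : Set (H →L[ℂ] H))).mp ?_
  refine Metric.isCompact_of_isClosed_isBounded isClosed_unitary ?_
  refine (Metric.isBounded_iff_subset_closedBall 0).2 ⟨1, fun V hV => ?_⟩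
  rw [mem_closedBall_zero_iff]
  rcases subsingleton_or_nontrivial (H →L[ℂ] H) with h | h
  · simp [Subsingleton.elim V 0]
  · exact (CStarRing.norm_of_mem_unitary hV).le

/-- The uniform (normalized Haar) distribution over a compact subgroup `K` of the unitary group,
as a distribution on the unitary group. -/
def uniformDist (K : Subgroup (unitary (H →L[ℂ] H))) [CompactSpace K] :
    MeasureTheory.Measure (unitary (H →L[ℂ] H)) :=
  (MeasureTheory.Measure.haarMeasure (⊤ : TopologicalSpace.PositiveCompacts K)).map Subtype.val

/-- The group generated by the one-parameter families `exp(-i H_l t)`, `t ∈ ℝ`. -/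
def generatedGroup {ι : Type*} (Ham : ι → H →L[ℂ] H) : Subgroup (unitary (H →L[ℂ] H)) :=
  Subgroup.closure
    {V | ∃ (l : ι) (t : ℝ), (V : H →L[ℂ] H) = NormedSpace.exp ((-Complex.I * (t : ℂ)) • Ham l)}

end Group

section Design

variable {κ : Type*} [Fintype κ] [DecidableEq κ]

/-- The tensor power `A^{⊗ t}` of a matrix, with rows and columns indexed by `t`-tuples. -/
def tensorPow (t : ℕ) (A : Matrix κ κ ℂ) : Matrix (Fin t → κ) (Fin t → κ) ℂ :=
  Matrix.of fun i j => ∏ a, A (i a) (j a)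

variable {H : Type*} [NormedAddCommGroup H] [InnerProductSpace ℂ H] [FiniteDimensional ℂ H]
  [CompleteSpace H]

/-- `V^{⊗ t} ⊗ (V*)^{⊗ t}`, where `V*` is the complex conjugate with respect to the
orthonormal basis `b`. -/
def momentMatrix (b : OrthonormalBasis κ ℂ H) (t : ℕ) (V : H →L[ℂ] H) :
    Matrix ((Fin t → κ) × (Fin t → κ)) ((Fin t → κ) × (Fin t → κ)) ℂ :=
  tensorPow t (LinearMap.toMatrix b.toBasis b.toBasis (V : H →ₗ[ℂ] H)) ⊗ₖ
    tensorPow t ((LinearMap.toMatrix b.toBasis b.toBasis (V : H →ₗ[ℂ] H)).map (starRingEnd ℂ))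

/-- The expectation of `V^{⊗ t} ⊗ (V*)^{⊗ t}` when `V` is distributed according to `ν`. -/
def expectedMoment (b : OrthonormalBasis κ ℂ H) (t : ℕ)
    (ν : MeasureTheory.Measure (unitary (H →L[ℂ] H))) :
    Matrix ((Fin t → κ) × (Fin t → κ)) ((Fin t → κ) × (Fin t → κ)) ℂ :=
  Matrix.of fun i j => ∫ V, momentMatrix b t (V : H →L[ℂ] H) i j ∂ν

/-- `ν` is a `t`-design for `μ`. -/
def IsTDesign (b : OrthonormalBasis κ ℂ H) (t : ℕ)
    (ν μ : MeasureTheory.Measure (unitary (H →L[ℂ] H))) : Prop :=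
  expectedMoment b t ν = expectedMoment b t μ

/-- The largest `t` for which `ν` is a `t`-design for `μ`, and `⊤` if it is one for arbitrarily
large `t` (the condition for `t` implies the one for all smaller `t`). -/
def tMax (b : OrthonormalBasis κ ℂ H) (ν μ : MeasureTheory.Measure (unitary (H →L[ℂ] H))) : ℕ∞ :=
  ⨆ (t : ℕ) (_ : IsTDesign b t ν μ), (t : ℕ∞)

end Design

section Symmetry

variable {G : Type*} [Group G]
variable {H : Type*} [NormedAddCommGroup H] [InnerProductSpace ℂ H] [FiniteDimensional ℂ H]
  [CompleteSpace H]

/-- The `G`-invariant unitaries `𝒱^G`: the unitaries that commute with all `U(g)`. -/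
def symUnitaries (U : G →* unitary (H →L[ℂ] H)) : Subgroup (unitary (H →L[ℂ] H)) :=
  Subgroup.centralizer (Set.range U)

instance compactSpace_symUnitaries (U : G →* unitary (H →L[ℂ] H)) :
    CompactSpace (symUnitaries U) := by
  refine isCompact_iff_compactSpace
    (s := (symUnitaries U : Set (unitary (H →L[ℂ] H)))).mp ?_
  exact (Set.isClosed_centralizer (Set.range U)).isCompact

/-- The commutator subgroup `𝒮𝒱^G = [𝒱^G, 𝒱^G]`. -/
def commSymUnitaries (U : G →* unitary (H →L[ℂ] H)) : Subgroup (unitary (H →L[ℂ] H)) :=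
  ⁅symUnitaries U, symUnitaries U⁆

/-- The linear representation of `G` on `H` underlying a unitary representation. -/
def linRep (U : G →* unitary (H →L[ℂ] H)) : Representation ℂ G H where
  toFun g := ((U g : H →L[ℂ] H) : H →ₗ[ℂ] H)
  map_one' := by simp
  map_mul' x y := by simp

instance isNoetherian_linRep (U : G →* unitary (H →L[ℂ] H)) :
    IsNoetherian ℂ[G] (linRep U).asModule := by
  have : IsNoetherian ℂ (linRep U).asModule := inferInstanceAs (IsNoetherian ℂ H)
  exact isNoetherian_of_tower ℂ this

/-- The inequivalent irreducible representations of `G` that appear in `H`. The irrep `λ` is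
represented by its isotypic component `𝒬_λ ⊗ ℳ_λ`, the sum of all subrepresentations of `H`
that are isomorphic to `λ`. -/
abbrev Irreps (U : G →* unitary (H →L[ℂ] H)) : Type _ :=
  isotypicComponents ℂ[G] (linRep U).asModule

instance fintypeIrreps (U : G →* unitary (H →L[ℂ] H)) : Fintype (Irreps U) :=
  Fintype.ofFinite _

/-- The isotypic component of the irrep `lam`, as a subspace of `H`. -/
def sector (U : G →* unitary (H →L[ℂ] H)) (lam : Irreps U) : Submodule ℂ H :=
  (Subrepresentation.subrepresentationSubmoduleOrderIso.symm lam.1).toSubmodule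

/-- The orthogonal projector `Π_λ` onto the isotypic component of the irrep `lam`. -/
def proj (U : G →* unitary (H →L[ℂ] H)) (lam : Irreps U) : H →L[ℂ] H :=
  (sector U lam).starProjection

/-- The multiplicity `m_λ = dim ℳ_λ` of the irrep `lam` in `H`: the number of irreducible summands
of its isotypic component. -/
def mult (U : G →* unitary (H →L[ℂ] H)) (lam : Irreps U) : ℕ :=
  (Module.length ℂ[G] lam.1).toNat

/-- The operator `Q = ∑_λ q(λ) m_λ Π_λ / Tr Π_λ`. -/
def opQ (U : G →* unitary (H →L[ℂ] H)) (q : Irreps U → ℤ) : H →L[ℂ] H :=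
  ∑ lam, ((q lam : ℂ) * (mult U lam : ℂ) / opTrace (proj U lam)) • proj U lam

/-- The integers `q` satisfy `‖Q‖₁ ≠ 0`, `Tr Q = 0` and `Tr (H_l Q) = 0` for all `l`. -/
def Admissible (U : G →* unitary (H →L[ℂ] H)) {ι : Type*} (Ham : ι → H →L[ℂ] H)
    (q : Irreps U → ℤ) : Prop :=
  traceNorm (opQ U q) ≠ 0 ∧ opTrace (opQ U q) = 0 ∧ ∀ l, opTrace (Ham l * opQ U q) = 0

end Symmetry

end SymDesign

end

/-!
The representation decomposes as `H = ⨁_λ 𝒬_λ ⊗ ℳ_λ`, and by Schur's lemma the `G`-invariant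
operators are the operators `⨁_λ 1 ⊗ A_λ`. This is made concrete by an orthonormal basis adapted
to the decomposition (`AdaptedBasis`, `nonempty_adaptedBasis`). Thus `𝒱^G` is the product of the
unitary groups of the spaces `ℳ_λ`, and its characters are the functions
`χ_q(V) = ∏_λ (det V_λ)^{q(λ)}` (`detChar`). As `Tr (A Q) = ∑_λ q(λ) Tr A_λ` for invariant `A`, the integers `q` are
admissible if and only if `χ_q` is nontrivial, but trivial on the global phases and on `𝒲^G`
(`admissible_iff`, `detChar_generatedGroup_iff`).

Equality of the `t`-th moments means equality of the averages of all polynomials of degree `t` in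
the entries of `V` and of degree `t` in those of `V*` (`isTDesign_iff_agree`). On `𝒱^G`, the
character of an admissible `q` is such a polynomial as soon as `‖Q‖₁ ≤ 2 t`. Its average over
`𝒲^G` is `1`, and its average over `𝒱^G` is `0`, so the moments differ (`not_agree_of_detChar`).

Conversely, let `W` be a compact subgroup of `𝒱^G` that contains the commutators, and let `P` be
the average over `W` of the matrices `V^{⊗ s} ⊗ (V*)^{⊗ t}`. In the adapted basis, the maximal
torus of diagonal matrices acts on these by weights, and the weights of nonzero rows of `P` are
trivial on the intersection of the torus with `W`. This intersection contains the commutators that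
move a phase from one basis vector of `ℳ_λ` to another one, so such a weight is constant on each
`ℳ_λ`: it is the restriction to the torus of some `χ_q`, and `χ_q` is trivial on `W` because every
element of `𝒱^G` is conjugate to one of the torus (`exists_detChar_of_weight`). If `q` is always
zero, the torus fixes `P`, hence `𝒱^G` does, and the averages over `W` and `𝒱^G` coincide
(`agree_or_exists_detChar`). For `W = 𝒲^G` and `s = t` this gives `isTDesign_iff`, from which the
formula for `t_max` follows.

If no `q` is admissible, the same dichotomy, with arbitrary `s` and `t`, is applied to the group
generated by `𝒲^G` and the global phases. Its uniform distribution and that of `𝒱^G` give the same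
averages of all polynomials, so they are equal by the Stone–Weierstrass theorem
(`measure_eq_of_agree`), and the groups, being their supports, are equal
(`symUnitaries_le_sup_phases`).
-/

set_option linter.unusedSectionVars false

noncomputable section

namespace SymDesign

open scoped InnerProductSpace
open MeasureTheory

/-! ### Subrepresentations and Schur's lemma -/

section Rep
variable {G : Type*} [Group G]
variable {H : Type*} [NormedAddCommGroup H] [InnerProductSpace ℂ H] [FiniteDimensional ℂ H]
  [CompleteSpace H]

/-- A `ℂ[G]`-submodule of `H`, seen as a complex subspace of `H`. -/
def subspaceOf {U : G →* unitary (H →L[ℂ] H)} (N : Submodule ℂ[G] (linRep U).asModule) :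
    Submodule ℂ H :=
  (Subrepresentation.subrepresentationSubmoduleOrderIso.symm N).toSubmodule

variable {U : G →* unitary (H →L[ℂ] H)}

/-- The group element `g`, as an element of the group algebra, acts as `U(g)`. -/
theorem single_smul_eq (g : G) (x : (linRep U).asModule) :
    (MonoidAlgebra.single g (1 : ℂ) : ℂ[G]) • x = (U g : H →L[ℂ] H) x := by
  rw [Representation.single_smul, one_smul]; rfl

theorem inner_unitary_left (g : G) (x y : H) :
    ⟪x, (U g : H →L[ℂ] H) y⟫_ℂ = ⟪(U g⁻¹ : H →L[ℂ] H) x, y⟫_ℂ := by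
  have h : (U g⁻¹ : H →L[ℂ] H) = ContinuousLinearMap.adjoint (U g : H →L[ℂ] H) := by
    rw [map_inv]; rfl
  rw [h, ContinuousLinearMap.adjoint_inner_left]

theorem smul_mem_subspaceOf (N : Submodule ℂ[G] (linRep U).asModule) (g : G) {x : H}
    (hx : x ∈ subspaceOf N) : (U g : H →L[ℂ] H) x ∈ subspaceOf N := by
  exact (congrArg (· ∈ N) (single_smul_eq g x)).mp (N.smul_mem (MonoidAlgebra.single g (1 : ℂ)) hx)

/-- Orthogonal complements of subrepresentations of a unitary representation are subrepresentations,
so these have complements. -/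
instance isSemisimpleModule_linRep : IsSemisimpleModule ℂ[G] (linRep U).asModule := by
  rw [isSemisimpleModule_iff]
  refine ⟨fun N => ?_⟩
  let P : Subrepresentation (linRep U) :=
    { toSubmodule := (subspaceOf N)ᗮ
      apply_mem_toSubmodule := fun g v hv => by
        rw [Submodule.mem_orthogonal] at hv ⊢
        intro u hu
        change ⟪u, (U g : H →L[ℂ] H) v⟫_ℂ = 0
        rw [inner_unitary_left]
        exact hv _ (smul_mem_subspaceOf N _ hu) }
  refine ⟨P.asSubmodule, ?_⟩
  have h := Submodule.isCompl_orthogonal (K := subspaceOf N)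
  constructor
  · rw [Submodule.disjoint_def] at *
    intro x hx hx'
    exact (Submodule.disjoint_def.1 h.disjoint) x hx hx'
  · rw [codisjoint_iff, eq_top_iff]
    intro x _
    have hx : (show H from x) ∈ subspaceOf N ⊔ (subspaceOf N)ᗮ := by
      rw [codisjoint_iff.1 h.codisjoint]; trivial
    obtain ⟨y, hy, z, hz, hyz⟩ := Submodule.mem_sup.1 hx
    exact Submodule.mem_sup.2 ⟨y, hy, z, hz, hyz⟩

/-- The complex-linear map underlying a homomorphism of `G`-representations. -/
def underlying {S : Submodule ℂ[G] (linRep U).asModule} (φ : S →ₗ[ℂ[G]] (linRep U).asModule) :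
    subspaceOf S →ₗ[ℂ] H where
  toFun x := φ ⟨x.1, x.2⟩
  map_add' x y := φ.map_add ⟨x.1, x.2⟩ ⟨y.1, y.2⟩
  map_smul' c x :=
    (φ.restrictScalars ℂ : S →ₗ[ℂ] (linRep U).asModule).map_smul c ⟨x.1, x.2⟩

theorem underlying_apply_unitary {S : Submodule ℂ[G] (linRep U).asModule}
    (φ : S →ₗ[ℂ[G]] (linRep U).asModule) (g : G) (x : subspaceOf S) :
    underlying φ ⟨(U g : H →L[ℂ] H) x, smul_mem_subspaceOf S g x.2⟩ =
      (U g : H →L[ℂ] H) (underlying φ x) := by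
  have := φ.map_smul (MonoidAlgebra.single g (1 : ℂ)) ⟨x.1, x.2⟩
  rw [single_smul_eq] at this
  rw [underlying]
  refine Eq.trans ?_ this
  change φ _ = φ _
  congr 1
  apply Subtype.ext
  exact (single_smul_eq (U := U) g x.1).symm

/-- The inner products of the values of two homomorphisms out of subrepresentations are given by a
homomorphism between these subrepresentations, namely by `ψ† φ`. -/
theorem exists_pairing {S S' : Submodule ℂ[G] (linRep U).asModule}
    (ψ : S' →ₗ[ℂ[G]] (linRep U).asModule) (φ : S →ₗ[ℂ[G]] (linRep U).asModule) :
    ∃ χ : S →ₗ[ℂ[G]] S', ∀ (y : subspaceOf S') (x : subspaceOf S),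
      ⟪underlying ψ y, underlying φ x⟫_ℂ = ⟪(y : H), (show H from (χ ⟨x.1, x.2⟩ : S').1)⟫_ℂ := by
  let T : subspaceOf S →ₗ[ℂ] subspaceOf S' := (LinearMap.adjoint (underlying ψ)) ∘ₗ underlying φ
  have hT : ∀ y x, ⟪underlying ψ y, underlying φ x⟫_ℂ = ⟪y, T x⟫_ℂ := fun y x => by
    simp [T, LinearMap.adjoint_inner_right]
  have hg : ∀ (g : G) (x : subspaceOf S),
      (T ⟨(U g : H →L[ℂ] H) x, smul_mem_subspaceOf S g x.2⟩ : H) = (U g : H →L[ℂ] H) (T x) := by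
    intro g x
    have key : T ⟨(U g : H →L[ℂ] H) x, smul_mem_subspaceOf S g x.2⟩ =
        ⟨(U g : H →L[ℂ] H) (T x), smul_mem_subspaceOf S' g (T x).2⟩ := by
      refine ext_inner_left ℂ fun y => ?_
      rw [← hT, underlying_apply_unitary, inner_unitary_left, ← underlying_apply_unitary, hT]
      simp only [Submodule.coe_inner]
      rw [inner_unitary_left]
    rw [key]
  let T' : S →ₗ[ℂ] S' :=
    { toFun := fun x => ⟨(T ⟨x.1, x.2⟩).1, (T ⟨x.1, x.2⟩).2⟩
      map_add' := fun x y => Subtype.ext (congrArg Subtype.val (T.map_add ⟨x.1, x.2⟩ ⟨y.1, y.2⟩))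
      map_smul' := fun c x => Subtype.ext (congrArg Subtype.val (T.map_smul c ⟨x.1, x.2⟩)) }
  refine ⟨MonoidAlgebra.equivariantOfLinearOfComm T' fun g x => Subtype.ext ?_, fun y x => ?_⟩
  · have h1 := hg g ⟨x.1, x.2⟩
    change (T ⟨_, _⟩ : H) =
      ((MonoidAlgebra.single g (1 : ℂ) : ℂ[G]) • (T' x).1 : (linRep U).asModule)
    refine Eq.trans ?_ (h1.trans (single_smul_eq g (T' x).1).symm)
    congr 2
    apply Subtype.ext
    exact single_smul_eq g x.1
  · rw [hT]; rfl

end Rep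

section Rep
variable {G : Type*} [Group G]
variable {H : Type*} [NormedAddCommGroup H] [InnerProductSpace ℂ H] [FiniteDimensional ℂ H]
  [CompleteSpace H]
variable {U : G →* unitary (H →L[ℂ] H)}

/-- Schur's lemma for the inner product: the homomorphism `ψ† φ` of a simple `S` is a scalar. -/
theorem inner_underlying_of_simple (S : Submodule ℂ[G] (linRep U).asModule)
    [IsSimpleModule ℂ[G] S] (ψ φ : S →ₗ[ℂ[G]] (linRep U).asModule) :
    ∃ μ : ℂ, ∀ x y : subspaceOf S, ⟪underlying ψ y, underlying φ x⟫_ℂ = μ * ⟪y, x⟫_ℂ := by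
  obtain ⟨χ, hχ⟩ := exists_pairing ψ φ
  have : FiniteDimensional ℂ (linRep U).asModule := inferInstanceAs (FiniteDimensional ℂ H)
  have : FiniteDimensional ℂ S := Module.Finite.of_injective
    (S.subtype.restrictScalars ℂ : S →ₗ[ℂ] (linRep U).asModule) Subtype.val_injective
  obtain ⟨μ, hμ⟩ := (IsSimpleModule.algebraMap_end_bijective_of_isAlgClosed (A := ℂ[G]) (V := S)
    ℂ).2 χ
  refine ⟨μ, fun x y => ?_⟩
  rw [hχ, ← hμ]
  exact inner_smul_right (y : H) (x : H) μ

/-- Schur's lemma for the inner product: the images of inequivalent irreps are orthogonal. -/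
theorem inner_underlying_of_not_iso {S S' : Submodule ℂ[G] (linRep U).asModule}
    [IsSimpleModule ℂ[G] S] [IsSimpleModule ℂ[G] S'] (h : IsEmpty (S ≃ₗ[ℂ[G]] S'))
    (ψ : S' →ₗ[ℂ[G]] (linRep U).asModule) (φ : S →ₗ[ℂ[G]] (linRep U).asModule)
    (x : subspaceOf S) (y : subspaceOf S') : ⟪underlying ψ y, underlying φ x⟫_ℂ = 0 := by
  obtain ⟨χ, hχ⟩ := exists_pairing ψ φ
  rcases χ.bijective_or_eq_zero with h1 | h1
  · exact (h.false (LinearEquiv.ofBijective χ h1)).elim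
  · rw [hχ, h1]
    exact inner_zero_right (y : H)

/-- The multiplicity space of a simple `S`, realized inside `H` as the set of values at `v` of the
homomorphisms `S → H`. For `v ≠ 0` a homomorphism is determined by its value at `v`. -/
def multSpace (S : Submodule ℂ[G] (linRep U).asModule) (v : subspaceOf S) : Submodule ℂ H where
  carrier := {h | ∃ φ : S →ₗ[ℂ[G]] (linRep U).asModule, underlying φ v = h}
  add_mem' := by
    rintro _ _ ⟨φ, rfl⟩ ⟨ψ, rfl⟩
    exact ⟨φ + ψ, rfl⟩
  zero_mem' := ⟨0, rfl⟩
  smul_mem' := by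
    rintro c _ ⟨φ, rfl⟩
    exact ⟨c • φ, rfl⟩

theorem underlying_sum_smul {S : Submodule ℂ[G] (linRep U).asModule} {m : ℕ} (c : Fin m → ℂ)
    (φ : Fin m → S →ₗ[ℂ[G]] (linRep U).asModule) (x : subspaceOf S) :
    underlying (∑ i, c i • φ i) x = ∑ i, c i • underlying (φ i) x := by
  have := LinearMap.sum_apply Finset.univ (fun i => c i • φ i) ⟨x.1, x.2⟩
  exact this

/-- An orthonormal basis of the multiplicity space of a simple `S` spreads, by Schur's lemma, to a
basis of `Hom(S, H)` made of isometric embeddings with pairwise orthogonal ranges. -/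
theorem exists_orthonormal_homs (S : Submodule ℂ[G] (linRep U).asModule)
    [IsSimpleModule ℂ[G] S] :
    ∃ (m : ℕ) (φ : Fin m → S →ₗ[ℂ[G]] (linRep U).asModule),
      (∀ i j x y, ⟪underlying (φ i) y, underlying (φ j) x⟫_ℂ = if i = j then ⟪y, x⟫_ℂ else 0) ∧
      (∀ ψ : S →ₗ[ℂ[G]] (linRep U).asModule, ∃ c : Fin m → ℂ, ψ = ∑ i, c i • φ i) := by
  have := IsSimpleModule.nontrivial ℂ[G] S
  obtain ⟨v', hv'⟩ := exists_ne (0 : S)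
  let w : subspaceOf S := ⟨v'.1, v'.2⟩
  have hw : w ≠ 0 := fun h => hv' (Subtype.ext (congrArg Subtype.val h))
  let v : subspaceOf S := ((‖w‖⁻¹ : ℝ) : ℂ) • w
  have hv : ‖v‖ = 1 := by
    have := norm_ne_zero_iff.2 hw
    rw [norm_smul, Complex.norm_real, norm_inv, norm_norm, inv_mul_cancel₀ this]
  have hv0 : v ≠ 0 := fun h => by simp [h] at hv
  let b := stdOrthonormalBasis ℂ (multSpace S v)
  choose φ hφ using fun i => (b i).2
  refine ⟨_, φ, fun i j x y => ?_, fun ψ => ?_⟩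
  · obtain ⟨μ, hμ⟩ := inner_underlying_of_simple S (φ i) (φ j)
    have h1 := hμ v v
    rw [hφ, hφ, inner_self_eq_norm_sq_to_K, hv, ← Submodule.coe_inner,
      orthonormal_iff_ite.1 b.orthonormal] at h1
    have h2 : μ = if i = j then 1 else 0 := by simpa using h1.symm
    rw [hμ, h2]
    split_ifs <;> simp
  · let u : multSpace S v := ⟨underlying ψ v, ψ, rfl⟩
    refine ⟨fun i => b.repr u i, ?_⟩
    have h1 : underlying (ψ - ∑ i, b.repr u i • φ i) v = 0 := by
      have h2 : underlying (ψ - ∑ i, b.repr u i • φ i) v =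
        underlying ψ v - underlying (∑ i, b.repr u i • φ i) v := rfl
      rw [h2, underlying_sum_smul]
      have h3 := congrArg Subtype.val (b.sum_repr u)
      simp only [hφ]
      rw [sub_eq_zero]
      simpa using h3.symm
    -- a homomorphism out of a simple module that vanishes at `v ≠ 0` is zero
    rcases LinearMap.injective_or_eq_zero (ψ - ∑ i, b.repr u i • φ i) with h | h
    · exact (hv0 (Subtype.ext (congrArg Subtype.val
        (h (h1.trans (map_zero (ψ - ∑ i, b.repr u i • φ i)).symm : _ = _) :
          (⟨v.1, v.2⟩ : S) = 0)))).elim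
    · exact sub_eq_zero.1 h

theorem apply_mem_isotypicComponent {S : Submodule ℂ[G] (linRep U).asModule}
    [IsSimpleModule ℂ[G] S] (φ : S →ₗ[ℂ[G]] (linRep U).asModule) (x : S) :
    φ x ∈ isotypicComponent ℂ[G] (linRep U).asModule S := by
  rcases LinearMap.injective_or_eq_zero φ with h | h
  · exact (le_sSup ⟨(LinearEquiv.ofInjective _ h).symm⟩ :
      LinearMap.range φ ≤ isotypicComponent ℂ[G] (linRep U).asModule S) ⟨_, rfl⟩
  · rw [h]; exact Submodule.zero_mem _

/-- If `φ` is an orthonormal basis of `Hom(S, H)` with `m` elements, then `(y_i) ↦ ∑ φ_i(y_i)` is an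
isomorphism from `S^m` onto the isotypic component of `S`. -/
theorem length_isotypicComponent {S : Submodule ℂ[G] (linRep U).asModule}
    [IsSimpleModule ℂ[G] S] {m : ℕ} {φ : Fin m → S →ₗ[ℂ[G]] (linRep U).asModule}
    (horth : ∀ i j x y, ⟪underlying (φ i) y, underlying (φ j) x⟫_ℂ =
      if i = j then ⟪y, x⟫_ℂ else 0)
    (hspan : ∀ ψ : S →ₗ[ℂ[G]] (linRep U).asModule, ∃ c : Fin m → ℂ, ψ = ∑ i, c i • φ i) :
    Module.length ℂ[G] (isotypicComponent ℂ[G] (linRep U).asModule S) = m ∧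
      ∀ x ∈ isotypicComponent ℂ[G] (linRep U).asModule S,
        ∃ y : Fin m → subspaceOf S, (show H from x) = ∑ i, underlying (φ i) (y i) := by
  let Φ : (Fin m → S) →ₗ[ℂ[G]] (linRep U).asModule :=
    ∑ i, φ i ∘ₗ LinearMap.proj i
  have hΦ : ∀ y, (show H from Φ y) = ∑ i, underlying (φ i) ⟨(y i).1, (y i).2⟩ := fun y => by
    have := LinearMap.sum_apply Finset.univ (fun i => φ i ∘ₗ LinearMap.proj (φ := fun _ => S) i) y
    exact this
  have hinj : Function.Injective Φ := by
    rw [injective_iff_map_eq_zero]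
    intro y hy
    funext i
    have h1 : ⟪underlying (φ i) ⟨(y i).1, (y i).2⟩, (show H from Φ y)⟫_ℂ = 0 := by
      rw [hy]; exact inner_zero_right _
    rw [hΦ, inner_sum] at h1
    simp only [horth, Finset.sum_ite_eq, Finset.mem_univ, if_true] at h1
    exact Subtype.ext (congrArg Subtype.val (inner_self_eq_zero.1 h1))
  have hrange : LinearMap.range Φ = isotypicComponent ℂ[G] (linRep U).asModule S := by
    apply le_antisymm
    · rintro _ ⟨y, rfl⟩
      have h1 : Φ y = ∑ i, φ i (y i) :=
        LinearMap.sum_apply Finset.univ (fun i => φ i ∘ₗ LinearMap.proj (φ := fun _ => S) i) y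
      rw [h1]
      exact Submodule.sum_mem _ fun i _ => apply_mem_isotypicComponent _ _
    · refine sSup_le ?_
      rintro N ⟨e⟩ x hx
      obtain ⟨c, hc⟩ := hspan (N.subtype ∘ₗ e.symm.toLinearMap)
      refine ⟨fun i => c i • e ⟨x, hx⟩, ?_⟩
      have h1 : Φ (fun i => c i • e ⟨x, hx⟩) = ∑ i, φ i (c i • e ⟨x, hx⟩) :=
        LinearMap.sum_apply Finset.univ (fun i => φ i ∘ₗ LinearMap.proj (φ := fun _ => S) i) _
      have h2 := congrArg (fun f => f (e ⟨x, hx⟩)) hc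
      simp only [LinearMap.comp_apply, LinearEquiv.coe_coe, LinearEquiv.symm_apply_apply,
        Submodule.subtype_apply] at h2
      refine Eq.trans (h1.trans ?_) h2.symm
      rw [LinearMap.sum_apply]
      exact Finset.sum_congr rfl fun i _ =>
        ((φ i).restrictScalars ℂ : S →ₗ[ℂ] (linRep U).asModule).map_smul _ _
  constructor
  · rw [← hrange, ← (LinearEquiv.ofInjective Φ hinj).length_eq, Module.length_pi,
      Module.length_eq_one]
    simp
  · intro x hx
    rw [← hrange] at hx
    obtain ⟨y, rfl⟩ := hx
    exact ⟨fun i => ⟨(y i).1, (y i).2⟩, hΦ y⟩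

end Rep

/-! ### Bases adapted to the isotypic decomposition -/

section Rep
variable {G : Type*} [Group G]
variable {H : Type*} [NormedAddCommGroup H] [InnerProductSpace ℂ H] [FiniteDimensional ℂ H]
  [CompleteSpace H]
variable {U : G →* unitary (H →L[ℂ] H)}

/-- An orthonormal basis of `H` adapted to the decomposition `H = ⨁_λ 𝒬_λ ⊗ ℳ_λ`: the vector
`vec ⟨λ, a, i⟩` is the tensor product of the `a`-th basis vector of the irrep `𝒬_λ` and of the `i`-th
basis vector of the multiplicity space `ℳ_λ`. The last field says that the operators commuting
with `G` are those of the form `⨁_λ 1 ⊗ c_λ`. -/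
structure AdaptedBasis (U : G →* unitary (H →L[ℂ] H)) where
  /-- The dimension of the irrep `𝒬_λ`. -/
  dim : Irreps U → ℕ
  /-- The vectors of the basis. -/
  vec : OrthonormalBasis (Σ lam : Irreps U, Fin (dim lam) × Fin (mult U lam)) ℂ H
  dim_pos : ∀ lam, 0 < dim lam
  mult_pos : ∀ lam, 0 < mult U lam
  proj_vec : ∀ lam x, proj U lam (vec x) = if x.1 = lam then vec x else 0
  commute_iff : ∀ A : H →L[ℂ] H, (∀ g, Commute A (U g : H →L[ℂ] H)) ↔
    ∃ c : ∀ lam, Matrix (Fin (mult U lam)) (Fin (mult U lam)) ℂ,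
      ∀ lam a i, A (vec ⟨lam, a, i⟩) = ∑ j, c lam j i • vec ⟨lam, a, j⟩

/-- The orthonormal basis of `Hom(S, H)`, for a simple `S` in the class of the irrep `λ`, is indexed
by the multiplicity of `λ`, and its members span the isotypic component. -/
theorem exists_irrep_homs (lam : Irreps U) :
    ∃ (S : Submodule ℂ[G] (linRep U).asModule) (_ : IsSimpleModule ℂ[G] S)
      (_ : lam.1 = isotypicComponent ℂ[G] (linRep U).asModule S)
      (φ : Fin (mult U lam) → S →ₗ[ℂ[G]] (linRep U).asModule),
      (∀ i j x y, ⟪underlying (φ i) y, underlying (φ j) x⟫_ℂ = if i = j then ⟪y, x⟫_ℂ else 0) ∧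
      (∀ ψ : S →ₗ[ℂ[G]] (linRep U).asModule, ∃ c : Fin (mult U lam) → ℂ, ψ = ∑ i, c i • φ i) ∧
      ∀ x ∈ sector U lam, ∃ y : Fin (mult U lam) → subspaceOf S,
        x = ∑ i, underlying (φ i) (y i) := by
  obtain ⟨S, hS, hlam⟩ := lam.2
  obtain ⟨m, φ, h1, h2⟩ := exists_orthonormal_homs S
  obtain ⟨h3, h4⟩ := length_isotypicComponent h1 h2
  have hm : m = mult U lam := by
    rw [mult, hlam, h3]; rfl
  subst hm
  refine ⟨S, hS, hlam, φ, h1, h2, fun x hx => h4 x ?_⟩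
  rw [← hlam]
  exact hx

/-- The images of an orthonormal basis of each irrep under an orthonormal basis of `Hom(𝒬_λ, H)`
form an adapted basis. -/
theorem nonempty_adaptedBasis (U : G →* unitary (H →L[ℂ] H)) : Nonempty (AdaptedBasis U) := by
  classical
  choose S hS hlam φ horth hspan hsec using exists_irrep_homs (U := U)
  let f := fun lam => stdOrthonormalBasis ℂ (subspaceOf (S lam))
  let v : (Σ lam : Irreps U, Fin (Module.finrank ℂ (subspaceOf (S lam))) × Fin (mult U lam)) → H :=
    fun x => underlying (φ x.1 x.2.2) (f x.1 x.2.1)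
  have hiso : ∀ lam mu, lam ≠ mu → IsEmpty (S lam ≃ₗ[ℂ[G]] S mu) := fun lam mu hne => by
    refine ⟨fun e => hne (Subtype.ext ?_)⟩
    rw [hlam, hlam, e.isotypicComponent_eq]
  have hon : Orthonormal ℂ v := by
    rw [orthonormal_iff_ite]
    rintro ⟨lam, a, i⟩ ⟨mu, b, j⟩
    by_cases hne : mu = lam
    · subst hne
      simp only [v, horth, orthonormal_iff_ite.1 (f mu).orthonormal, Sigma.mk.injEq, heq_eq_eq,
        true_and, Prod.mk.injEq]
      by_cases h1 : i = j <;> by_cases h2 : a = b <;> simp [h1, h2]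
    · have h1 := inner_underlying_of_not_iso (hiso _ _ hne) (φ lam i) (φ mu j) (f mu b) (f lam a)
      rw [if_neg (fun h => hne (congrArg Sigma.fst h).symm)]
      exact h1
  have hmem : ∀ x, v x ∈ sector U x.1 := fun x => by
    have := apply_mem_isotypicComponent (φ x.1 x.2.2) ⟨(f x.1 x.2.1).1, (f x.1 x.2.1).2⟩
    rw [← hlam] at this
    exact this
  have hspanv : ∀ lam, ∀ x ∈ sector U lam, x ∈ Submodule.span ℂ (Set.range v) := by
    intro lam x hx
    obtain ⟨y, rfl⟩ := hsec lam x hx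
    refine Submodule.sum_mem _ fun i _ => ?_
    rw [← (f lam).sum_repr (y i), map_sum]
    refine Submodule.sum_mem _ fun a _ => ?_
    rw [map_smul]
    exact Submodule.smul_mem _ _ (Submodule.subset_span ⟨⟨lam, a, i⟩, rfl⟩)
  have htop : ⊤ ≤ Submodule.span ℂ (Set.range v) := by
    intro x _
    have hx : (show (linRep U).asModule from x) ∈
        ⨆ lam : Irreps U, (lam.1 : Submodule ℂ[G] (linRep U).asModule) := by
      rw [← sSup_eq_iSup', sSup_isotypicComponents]; trivial
    refine Submodule.iSup_induction (fun lam : Irreps U => lam.1)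
      (motive := fun y => (show H from y) ∈ Submodule.span ℂ (Set.range v)) hx
      (fun lam y hy => hspanv lam y hy) (Submodule.zero_mem _)
      (fun y z hy hz => Submodule.add_mem _ hy hz)
  let e := OrthonormalBasis.mk hon htop
  have he : ∀ x, e x = v x := fun x => by simp [e]
  refine ⟨⟨fun lam => Module.finrank ℂ (subspaceOf (S lam)), e, fun lam => ?_, fun lam => ?_,
    fun lam x => ?_, fun A => ⟨fun hA => ?_, ?_⟩⟩⟩
  · have := IsSimpleModule.nontrivial ℂ[G] (S lam)
    obtain ⟨x, hx⟩ := exists_ne (0 : S lam)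
    have : Nontrivial (subspaceOf (S lam)) :=
      ⟨⟨x.1, x.2⟩, 0, fun h => hx (Subtype.ext (congrArg Subtype.val h))⟩
    exact Module.finrank_pos
  · by_contra h0
    have hm : mult U lam = 0 := by omega
    obtain ⟨x, hx, hx0⟩ := (Submodule.ne_bot_iff _).1 (bot_lt_isotypicComponents lam.2).ne'
    obtain ⟨y, hy⟩ := hsec lam x hx
    have : IsEmpty (Fin (mult U lam)) := by rw [hm]; infer_instance
    rw [Finset.univ_eq_empty, Finset.sum_empty] at hy
    exact hx0 hy
  · rw [he, proj]
    split_ifs with h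
    · subst h
      exact Submodule.starProjection_eq_self_iff.2 (hmem x)
    · rw [Submodule.starProjection_apply_eq_zero_iff, Submodule.mem_orthogonal]
      intro y hy
      obtain ⟨y, rfl⟩ := hsec lam y hy
      rw [sum_inner]
      exact Finset.sum_eq_zero fun i _ => inner_underlying_of_not_iso (hiso _ _ h) _ _ _ _
  · have hA' : ∀ g (x : H), A ((U g : H →L[ℂ] H) x) = (U g : H →L[ℂ] H) (A x) := fun g x =>
      congrArg (fun T : H →L[ℂ] H => T x) (hA g)
    let A' : (linRep U).asModule →ₗ[ℂ[G]] (linRep U).asModule :=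
      MonoidAlgebra.equivariantOfLinearOfComm (show (linRep U).asModule →ₗ[ℂ] (linRep U).asModule
        from (A : H →ₗ[ℂ] H)) fun g x => by
          have h1 := single_smul_eq g x
          have h2 := single_smul_eq g (show (linRep U).asModule from A x)
          exact (congrArg A h1).trans ((hA' g x).trans h2.symm)
    choose c hc using fun lam i => hspan lam (A' ∘ₗ φ lam i)
    refine ⟨fun lam => Matrix.of fun j i => c lam i j, fun lam a i => ?_⟩
    simp only [he]
    have h1 : A (v ⟨lam, a, i⟩) = underlying (A' ∘ₗ φ lam i) (f lam a) := rfl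
    rw [h1, hc, underlying_sum_smul]
    rfl
  · rintro ⟨c, hc⟩ g
    have key : ∀ lam i y, A (underlying (φ lam i) y) =
        ∑ j, c lam j i • underlying (φ lam j) y := by
      intro lam i y
      have : (A : H →ₗ[ℂ] H) ∘ₗ underlying (φ lam i) = ∑ j, c lam j i • underlying (φ lam j) := by
        refine (f lam).toBasis.ext fun a => ?_
        have h1 := hc lam a i
        simp only [he] at h1
        simpa [LinearMap.sum_apply] using h1
      have h2 := congrArg (fun T => T y) this
      simpa [LinearMap.sum_apply] using h2
    have : (A * (U g : H →L[ℂ] H) : H →L[ℂ] H).toLinearMap =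
        ((U g : H →L[ℂ] H) * A : H →L[ℂ] H).toLinearMap := by
      refine e.toBasis.ext fun x => ?_
      obtain ⟨lam, a, i⟩ := x
      change A ((U g : H →L[ℂ] H) (e.toBasis ⟨lam, a, i⟩)) =
        (U g : H →L[ℂ] H) (A (e.toBasis ⟨lam, a, i⟩))
      rw [OrthonormalBasis.coe_toBasis, he]
      change A ((U g : H →L[ℂ] H) (underlying (φ lam i) (f lam a))) =
        (U g : H →L[ℂ] H) (A (underlying (φ lam i) (f lam a)))
      rw [← underlying_apply_unitary, key, key, map_sum]
      refine Finset.sum_congr rfl fun j _ => ?_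
      rw [map_smul, underlying_apply_unitary]
    exact ContinuousLinearMap.coe_injective this

end Rep

/-! ### Diagonalization of unitary matrices -/

section UnitaryMatrix
variable {n : Type*} [Fintype n] [DecidableEq n]
open Matrix

/-- A Hermitian matrix is diagonalized by a unitary matrix. -/
theorem exists_hermitian_diagonalization {A : Matrix n n ℂ} (hA : A.IsHermitian) :
    ∃ g ∈ unitary (Matrix n n ℂ), ∃ d : n → ℝ,
      A = g * diagonal (fun i => (d i : ℂ)) * star g := by
  have := hA.spectral_theorem
  rw [Unitary.conjStarAlgAut_apply] at this
  exact ⟨_, hA.eigenvectorUnitary.2, hA.eigenvalues, this⟩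

/-- A unitary matrix is diagonalized by a unitary matrix, namely by one that diagonalizes its Cayley
transform, which is Hermitian. -/
theorem exists_unitary_diagonalization {V : Matrix n n ℂ} (hV : V ∈ unitary (Matrix n n ℂ)) :
    ∃ g ∈ unitary (Matrix n n ℂ), ∃ z : n → ℂ, (∀ i, ‖z i‖ = 1) ∧
      V = g * diagonal z * star g := by
  -- a point `ζ` of the unit circle with `-ζ` outside the spectrum of `V`
  obtain ⟨ζ, hζ1, hζ⟩ : ∃ ζ : ℂ, ‖ζ‖ = 1 ∧ -ζ ∉ spectrum ℂ V := by
    have hinf : (Metric.sphere (0 : ℂ) 1).Infinite := by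
      refine Set.infinite_of_injective_forall_mem
        (f := fun k : ℕ => Complex.exp (((1 : ℝ) / (k + 1) : ℝ) * Complex.I)) ?_ ?_
      · intro k l h
        have h1 : ∀ k : ℕ, ((1 : ℝ) / (k + 1)) ∈ Set.Ioc (-Real.pi) Real.pi := fun k => by
          have : (0 : ℝ) < 1 / (k + 1) := by positivity
          have h2 : (1 : ℝ) / (k + 1) ≤ 1 := by
            rw [div_le_one (by positivity)]; linarith [k.cast_nonneg (α := ℝ)]
          constructor <;> linarith [Real.pi_gt_three]
        have h2 := congrArg Complex.arg h
        simp only [Complex.exp_mul_I] at h2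
        rw [Complex.arg_cos_add_sin_mul_I (h1 k), Complex.arg_cos_add_sin_mul_I (h1 l)] at h2
        have hk : (0 : ℝ) < k + 1 := by positivity
        have hl : (0 : ℝ) < l + 1 := by positivity
        field_simp at h2
        exact_mod_cast (by linarith : (k : ℝ) = l)
      · intro k
        rw [mem_sphere_zero_iff_norm]
        exact Complex.norm_exp_ofReal_mul_I _
    obtain ⟨w, hw, hw'⟩ := hinf.exists_notMem_finset (Matrix.finite_spectrum V).toFinset
    refine ⟨-w, by simpa using hw, by simpa using hw'⟩
  have hζc : ζ * star ζ = 1 := by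
    rw [Complex.star_def, Complex.mul_conj, Complex.normSq_eq_norm_sq, hζ1]; norm_num
  have hVV := (Unitary.mem_iff.1 hV).2
  obtain ⟨C, hC⟩ : IsUnit (ζ • (1 : Matrix n n ℂ) + V) := by
    have h1 := spectrum.notMem_iff.1 hζ
    have h2 : ζ • (1 : Matrix n n ℂ) + V = -((algebraMap ℂ (Matrix n n ℂ)) (-ζ) - V) := by
      rw [Algebra.algebraMap_eq_smul_one]; simp [add_comm]
    rw [h2]; exact h1.neg
  have hsC : star (C : Matrix n n ℂ) = star ζ • 1 + star V := by rw [hC]; simp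
  -- the Cayley transform of `V`
  have hA : IsHermitian (Complex.I • (ζ • (↑C⁻¹ : Matrix n n ℂ) - (1 / 2 : ℂ) • 1)) := by
    have key : ζ • (↑C⁻¹ : Matrix n n ℂ) + star ζ • star (↑C⁻¹ : Matrix n n ℂ) = 1 := by
      have h1 : (C : Matrix n n ℂ) * (ζ • (↑C⁻¹ : Matrix n n ℂ) +
          star ζ • star (↑C⁻¹ : Matrix n n ℂ)) * star (C : Matrix n n ℂ) =
          (C : Matrix n n ℂ) * star (C : Matrix n n ℂ) := by
        have h2 : star (↑C⁻¹ : Matrix n n ℂ) * star (C : Matrix n n ℂ) = 1 := by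
          rw [← star_mul, Units.mul_inv, star_one]
        rw [mul_add, add_mul, mul_smul_comm, Units.mul_inv, mul_smul_comm, smul_mul_assoc,
          smul_mul_assoc, mul_assoc, h2, mul_one, one_mul, hsC, hC]
        simp only [mul_add, add_mul, smul_mul_assoc, mul_smul_comm, one_mul, mul_one, smul_add,
          smul_smul, hVV, hζc]
        rw [mul_comm (star ζ) ζ, hζc, one_smul]
        abel
      have hu : IsUnit (star (C : Matrix n n ℂ)) := C.isUnit.star
      have h3 := hu.mul_right_cancel (h1.trans (by rw [mul_one] :
        (C : Matrix n n ℂ) * star (C : Matrix n n ℂ) =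
          (C : Matrix n n ℂ) * 1 * star (C : Matrix n n ℂ)))
      exact C.isUnit.mul_left_cancel h3
    have h4 : star ζ • star (↑C⁻¹ : Matrix n n ℂ) = 1 - ζ • (↑C⁻¹ : Matrix n n ℂ) :=
      eq_sub_of_add_eq' key
    change star _ = _
    rw [star_smul, star_sub, star_smul, star_smul, star_one, h4]
    simp only [Complex.star_def, Complex.conj_I, map_div₀, map_one, map_ofNat]
    have h5 : (1 : Matrix n n ℂ) = (1 / 2 : ℂ) • 1 + (1 / 2 : ℂ) • 1 := by
      rw [← add_smul]; norm_num
    nth_rw 1 [h5]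
    module
  set A := Complex.I • (ζ • (↑C⁻¹ : Matrix n n ℂ) - (1 / 2 : ℂ) • 1) with hAdef
  obtain ⟨g, hg, ev, hAg⟩ := exists_hermitian_diagonalization hA
  have hgs : star g * g = 1 := (Unitary.mem_iff.1 hg).1
  have hgs' : g * star g = 1 := (Unitary.mem_iff.1 hg).2
  have hspec : star g * A * g = diagonal (fun i => (ev i : ℂ)) := by
    rw [hAg]
    simp only [mul_assoc, hgs, mul_one]
    rw [← mul_assoc, hgs, one_mul]
  -- hence `g` diagonalizes `C⁻¹`, then `C`, then `V`
  obtain ⟨d, hd⟩ : ∃ d, star g * (↑C⁻¹ : Matrix n n ℂ) * g = diagonal d := by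
    have hC' : (↑C⁻¹ : Matrix n n ℂ) = (star ζ * (-Complex.I)) • A + (star ζ * (1 / 2)) • 1 := by
      rw [hAdef, smul_smul, smul_sub, smul_smul, smul_smul]
      have h1 : star ζ * -Complex.I * Complex.I = star ζ := by
        rw [mul_assoc, neg_mul, Complex.I_mul_I]; ring
      rw [h1, mul_comm (star ζ) ζ, hζc, one_smul]; simp
    refine ⟨fun i => (star ζ * (-Complex.I)) * (ev i : ℂ) + star ζ * (1 / 2), ?_⟩
    rw [hC', mul_add, add_mul, mul_smul_comm, smul_mul_assoc, hspec, mul_smul_comm, smul_mul_assoc,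
      mul_one, hgs]
    ext i j
    by_cases h : i = j
    · subst h; simp
    · simp [h]
  have hd1 : diagonal d * (star g * (C : Matrix n n ℂ) * g) = 1 := by
    rw [← hd]
    simp only [mul_assoc]
    rw [← mul_assoc g, hgs', one_mul, ← mul_assoc (↑C⁻¹ : Matrix n n ℂ), Units.inv_mul, one_mul,
      hgs]
  have hd0 : ∀ i, d i ≠ 0 := fun i h => by
    have := congrFun (congrFun hd1 i) i
    rw [diagonal_mul, h] at this
    simp at this
  have hV1 : star g * V * g = diagonal (fun i => (d i)⁻¹ - ζ) := by
    have h1 : star g * (C : Matrix n n ℂ) * g = diagonal (fun i => (d i)⁻¹) := by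
      ext i j
      have h2 := congrFun (congrFun hd1 i) j
      rw [diagonal_mul] at h2
      have h3 : (star g * (C : Matrix n n ℂ) * g) i j = (d i)⁻¹ * (1 : Matrix n n ℂ) i j := by
        rw [← h2, ← mul_assoc, inv_mul_cancel₀ (hd0 i), one_mul]
      rw [h3]
      by_cases h : i = j
      · subst h; simp
      · simp [h]
    have h2 : V = (C : Matrix n n ℂ) - ζ • 1 := by rw [hC]; simp
    rw [h2, mul_sub, sub_mul, h1, mul_smul_comm, mul_one, smul_mul_assoc, hgs]
    ext i j
    by_cases h : i = j
    · subst h; simp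
    · simp [h]
  have hV2 : V = g * diagonal (fun i => (d i)⁻¹ - ζ) * star g := by
    rw [← hV1]
    simp only [mul_assoc, hgs', mul_one]
    rw [← mul_assoc, hgs', one_mul]
  refine ⟨g, hg, _, fun i => ?_, hV2⟩
  have h1 : star (star g * V * g) * (star g * V * g) = 1 := by
    have : star g * V * g ∈ unitary (Matrix n n ℂ) :=
      mul_mem (mul_mem (Unitary.star_mem hg) hV) hg
    exact (Unitary.mem_iff.1 this).1
  rw [hV1, star_eq_conjTranspose, diagonal_conjTranspose, diagonal_mul_diagonal] at h1
  have h2 := congrFun (congrFun h1 i) i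
  rw [diagonal_apply_eq, one_apply_eq, Pi.star_apply, Complex.star_def, mul_comm, Complex.mul_conj,
    Complex.normSq_eq_norm_sq] at h2
  have h3 : ‖(d i)⁻¹ - ζ‖ ^ 2 = 1 := by exact_mod_cast h2
  exact (pow_eq_one_iff_of_nonneg (norm_nonneg _) two_ne_zero).1 h3

end UnitaryMatrix

/-! ### Blocks of invariant operators -/

section Blocks
variable {G : Type*} [Group G]
variable {H : Type*} [NormedAddCommGroup H] [InnerProductSpace ℂ H] [FiniteDimensional ℂ H]
  [CompleteSpace H]
variable {U : G →* unitary (H →L[ℂ] H)}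

/-- The operator `A` commutes with the representation. -/
def IsInvariant (U : G →* unitary (H →L[ℂ] H)) (A : H →L[ℂ] H) : Prop :=
  ∀ g, Commute A (U g : H →L[ℂ] H)

theorem isInvariant_of_mem {V : unitary (H →L[ℂ] H)} (hV : V ∈ symUnitaries U) :
    IsInvariant U (V : H →L[ℂ] H) := fun g => by
  have := Subgroup.mem_centralizer_iff.1 hV _ ⟨g, rfl⟩
  exact (congrArg Subtype.val this).symm

theorem mem_symUnitaries_of_isInvariant {V : unitary (H →L[ℂ] H)}
    (hV : IsInvariant U (V : H →L[ℂ] H)) : V ∈ symUnitaries U := by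
  refine Subgroup.mem_centralizer_iff.2 ?_
  rintro _ ⟨g, rfl⟩
  exact Subtype.ext (hV g).eq.symm

namespace AdaptedBasis

variable (B : AdaptedBasis U)

/-- The block `c_λ` of an operator `⨁_λ 1 ⊗ c_λ`, read off at the first basis vector of `𝒬_λ`. It is
defined, and linear, for all operators, but describes only the invariant ones. -/
def block (lam : Irreps U) (A : H →L[ℂ] H) : Matrix (Fin (mult U lam)) (Fin (mult U lam)) ℂ :=
  Matrix.of fun j i =>
    ⟪B.vec ⟨lam, ⟨0, B.dim_pos lam⟩, j⟩, A (B.vec ⟨lam, ⟨0, B.dim_pos lam⟩, i⟩)⟫_ℂ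

theorem apply_vec {A : H →L[ℂ] H} (hA : IsInvariant U A) (lam : Irreps U) (a : Fin (B.dim lam))
    (i : Fin (mult U lam)) :
    A (B.vec ⟨lam, a, i⟩) = ∑ j, B.block lam A j i • B.vec ⟨lam, a, j⟩ := by
  obtain ⟨c, hc⟩ := (B.commute_iff A).1 hA
  have h : B.block lam A = c lam := by
    ext j k
    rw [block, Matrix.of_apply, hc, inner_sum]
    simp [inner_smul_right, orthonormal_iff_ite.1 B.vec.orthonormal]
  rw [hc, h]

theorem ext_vec {A A' : H →L[ℂ] H} (h : ∀ x, A (B.vec x) = A' (B.vec x)) : A = A' := by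
  apply ContinuousLinearMap.coe_injective
  refine B.vec.toBasis.ext fun x => ?_
  simpa using h x

theorem ext_block {A A' : H →L[ℂ] H} (hA : IsInvariant U A) (hA' : IsInvariant U A')
    (h : ∀ lam, B.block lam A = B.block lam A') : A = A' :=
  B.ext_vec fun ⟨lam, a, i⟩ => by rw [B.apply_vec hA, B.apply_vec hA', h]

theorem block_add (lam : Irreps U) (A A' : H →L[ℂ] H) :
    B.block lam (A + A') = B.block lam A + B.block lam A' := by
  ext; simp [block]

theorem block_smul (lam : Irreps U) (c : ℂ) (A : H →L[ℂ] H) :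
    B.block lam (c • A) = c • B.block lam A := by
  ext; simp [block]

theorem block_one (lam : Irreps U) : B.block lam 1 = 1 := by
  ext i j
  rw [block, Matrix.of_apply, one_apply_eq_self,
    orthonormal_iff_ite.1 B.vec.orthonormal, Matrix.one_apply]
  simp

theorem block_star (lam : Irreps U) (A : H →L[ℂ] H) :
    B.block lam (star A) = star (B.block lam A) := by
  ext i j
  simp only [block, Matrix.of_apply, Matrix.star_apply, ContinuousLinearMap.star_eq_adjoint,
    ContinuousLinearMap.adjoint_inner_right]
  exact (inner_conj_symm _ _).symm

theorem block_mul (lam : Irreps U) (A : H →L[ℂ] H) {A' : H →L[ℂ] H} (hA' : IsInvariant U A') :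
    B.block lam (A * A') = B.block lam A * B.block lam A' := by
  ext i j
  rw [Matrix.mul_apply, block, Matrix.of_apply, mul_apply_eq_comp, B.apply_vec hA', map_sum,
    inner_sum]
  refine Finset.sum_congr rfl fun k _ => ?_
  rw [map_smul, inner_smul_right, mul_comm]
  rfl

/-- The operator `⨁_λ 1 ⊗ c_λ`. -/
def ofBlocks (c : ∀ lam, Matrix (Fin (mult U lam)) (Fin (mult U lam)) ℂ) : H →L[ℂ] H :=
  LinearMap.toContinuousLinearMap (B.vec.toBasis.constr ℂ fun x =>
    ∑ j, c x.1 j x.2.2 • B.vec ⟨x.1, x.2.1, j⟩)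

theorem ofBlocks_vec (c : ∀ lam, Matrix (Fin (mult U lam)) (Fin (mult U lam)) ℂ) (lam : Irreps U)
    (a : Fin (B.dim lam)) (i : Fin (mult U lam)) :
    B.ofBlocks c (B.vec ⟨lam, a, i⟩) = ∑ j, c lam j i • B.vec ⟨lam, a, j⟩ := by
  have := B.vec.toBasis.constr_basis ℂ (fun x : Σ lam : Irreps U,
      Fin (B.dim lam) × Fin (mult U lam) => ∑ j, c x.1 j x.2.2 • B.vec ⟨x.1, x.2.1, j⟩) ⟨lam, a, i⟩
  rw [OrthonormalBasis.coe_toBasis] at this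
  exact this

theorem isInvariant_ofBlocks (c : ∀ lam, Matrix (Fin (mult U lam)) (Fin (mult U lam)) ℂ) :
    IsInvariant U (B.ofBlocks c) :=
  (B.commute_iff _).2 ⟨c, B.ofBlocks_vec c⟩

theorem block_ofBlocks (c : ∀ lam, Matrix (Fin (mult U lam)) (Fin (mult U lam)) ℂ)
    (lam : Irreps U) : B.block lam (B.ofBlocks c) = c lam := by
  ext j k
  rw [block, Matrix.of_apply, ofBlocks_vec, inner_sum]
  simp [inner_smul_right, orthonormal_iff_ite.1 B.vec.orthonormal]

theorem _root_.SymDesign.IsInvariant.mul {A A' : H →L[ℂ] H} (hA : IsInvariant U A)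
    (hA' : IsInvariant U A') : IsInvariant U (A * A') := fun g => (hA g).mul_left (hA' g)

theorem _root_.SymDesign.IsInvariant.one : IsInvariant U (1 : H →L[ℂ] H) :=
  fun _ => Commute.one_left _

theorem isInvariant_star {A : H →L[ℂ] H} (hA : IsInvariant U A) : IsInvariant U (star A) := by
  intro g
  have h1 := (hA g⁻¹).star_star
  have h2 : star (U g⁻¹ : H →L[ℂ] H) = (U g : H →L[ℂ] H) := by
    rw [map_inv, ← Unitary.coe_star, ← Unitary.star_eq_inv, star_star]
  rwa [h2] at h1

theorem ofBlocks_mem_unitary {c : ∀ lam, Matrix (Fin (mult U lam)) (Fin (mult U lam)) ℂ}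
    (hc : ∀ lam, c lam ∈ unitary (Matrix (Fin (mult U lam)) (Fin (mult U lam)) ℂ)) :
    B.ofBlocks c ∈ unitary (H →L[ℂ] H) := by
  have h := B.isInvariant_ofBlocks c
  have h' := isInvariant_star h
  refine Unitary.mem_iff.2 ⟨B.ext_block (h'.mul h) .one fun lam => ?_,
    B.ext_block (h.mul h') .one fun lam => ?_⟩
  · rw [B.block_mul lam _ h, block_star, block_ofBlocks, block_one, (Unitary.mem_iff.1 (hc lam)).1]
  · rw [B.block_mul lam _ h', block_star, block_ofBlocks, block_one,
      (Unitary.mem_iff.1 (hc lam)).2]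

/-- The invariant unitary with given unitary blocks. -/
def unitaryOfBlocks (c : ∀ lam, unitary (Matrix (Fin (mult U lam)) (Fin (mult U lam)) ℂ)) :
    unitary (H →L[ℂ] H) :=
  ⟨B.ofBlocks fun lam => c lam, B.ofBlocks_mem_unitary fun lam => (c lam).2⟩

theorem block_unitaryOfBlocks
    (c : ∀ lam, unitary (Matrix (Fin (mult U lam)) (Fin (mult U lam)) ℂ)) (lam : Irreps U) :
    B.block lam (B.unitaryOfBlocks c) = c lam :=
  B.block_ofBlocks (fun lam => c lam) lam

theorem unitaryOfBlocks_mem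
    (c : ∀ lam, unitary (Matrix (Fin (mult U lam)) (Fin (mult U lam)) ℂ)) :
    B.unitaryOfBlocks c ∈ symUnitaries U :=
  mem_symUnitaries_of_isInvariant (V := B.unitaryOfBlocks c)
    (B.isInvariant_ofBlocks fun lam => c lam)

theorem block_mem_unitary (lam : Irreps U) {V : unitary (H →L[ℂ] H)} (hV : V ∈ symUnitaries U) :
    B.block lam V ∈ unitary (Matrix (Fin (mult U lam)) (Fin (mult U lam)) ℂ) := by
  have h := isInvariant_of_mem hV
  refine Unitary.mem_iff.2 ⟨?_, ?_⟩
  · rw [← block_star, ← B.block_mul lam _ h, (Unitary.mem_iff.1 V.2).1, block_one]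
  · rw [← block_star, ← B.block_mul lam _ (isInvariant_star h), (Unitary.mem_iff.1 V.2).2,
      block_one]

theorem ext_unitary {V W : unitary (H →L[ℂ] H)} (hV : V ∈ symUnitaries U)
    (hW : W ∈ symUnitaries U) (h : ∀ lam, B.block lam V = B.block lam W) : V = W :=
  Subtype.ext (B.ext_block (isInvariant_of_mem hV) (isInvariant_of_mem hW) h)

theorem block_coe_mul (lam : Irreps U) {V W : unitary (H →L[ℂ] H)} (hW : W ∈ symUnitaries U) :
    B.block lam (V * W : unitary (H →L[ℂ] H)) = B.block lam V * B.block lam W :=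
  B.block_mul lam _ (isInvariant_of_mem hW)

theorem block_coe_inv (lam : Irreps U) (V : unitary (H →L[ℂ] H)) :
    B.block lam (V⁻¹ : unitary (H →L[ℂ] H)) = star (B.block lam V) :=
  B.block_star lam _

/-! ### Traces -/

theorem opTrace_mul_proj (lam : Irreps U) {A : H →L[ℂ] H} (hA : IsInvariant U A) :
    opTrace (A * proj U lam) = B.dim lam * (B.block lam A).trace := by
  rw [opTrace, LinearMap.trace_eq_sum_inner _ B.vec, Fintype.sum_sigma,
    Finset.sum_eq_single lam]
  · rw [Fintype.sum_prod_type]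
    have h1 : ∀ a i, ⟪B.vec ⟨lam, a, i⟩, ((A * proj U lam : H →L[ℂ] H) : H →ₗ[ℂ] H)
        (B.vec ⟨lam, a, i⟩)⟫_ℂ = B.block lam A i i := fun a i => by
      change ⟪_, A (proj U lam _)⟫_ℂ = _
      rw [B.proj_vec, if_pos rfl, B.apply_vec hA, inner_sum]
      simp [inner_smul_right, orthonormal_iff_ite.1 B.vec.orthonormal]
    simp only [h1, Finset.sum_const, Finset.card_univ, Fintype.card_fin, nsmul_eq_mul]
    rfl
  · intro mu _ hne
    refine Finset.sum_eq_zero fun x _ => ?_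
    change ⟪_, A (proj U lam _)⟫_ℂ = _
    rw [B.proj_vec, if_neg hne, map_zero, inner_zero_right]
  · simp

theorem opTrace_proj (lam : Irreps U) :
    opTrace (proj U lam) = B.dim lam * mult U lam := by
  have := B.opTrace_mul_proj lam IsInvariant.one
  rwa [one_mul, block_one, Matrix.trace_one, Fintype.card_fin] at this

end AdaptedBasis
end Blocks

/-! ### The maximal torus of the group of invariant unitaries -/

section Torus
open scoped commutatorElement
variable {G : Type*} [Group G]
variable {H : Type*} [NormedAddCommGroup H] [InnerProductSpace ℂ H] [FiniteDimensional ℂ H]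
  [CompleteSpace H]
variable {U : G →* unitary (H →L[ℂ] H)}

namespace AdaptedBasis

variable (B : AdaptedBasis U)

theorem diagonal_circle_mem_unitary {n : Type*} [Fintype n] [DecidableEq n] (z : n → Circle) :
    Matrix.diagonal (fun i => (z i : ℂ)) ∈ unitary (Matrix n n ℂ) := by
  have h : ∀ i, (z i : ℂ) * star (z i : ℂ) = 1 := fun i => by
    rw [Complex.star_def, Complex.mul_conj, Circle.normSq_coe, Complex.ofReal_one]
  refine Unitary.mem_iff.2 ⟨?_, ?_⟩ <;>
  · rw [Matrix.star_eq_conjTranspose, Matrix.diagonal_conjTranspose, Matrix.diagonal_mul_diagonal,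
      ← Matrix.diagonal_one]
    congr 1
    funext i
    simp only [Pi.star_apply]
    first
    | exact h i
    | exact (mul_comm _ _).trans (h i)

/-- The maximal torus of `𝒱^G` formed by the operators that are diagonal in the adapted basis. -/
def torus (z : (Σ lam : Irreps U, Fin (mult U lam)) → Circle) : unitary (H →L[ℂ] H) :=
  B.unitaryOfBlocks fun lam => ⟨_, diagonal_circle_mem_unitary fun i => z ⟨lam, i⟩⟩

theorem torus_mem (z : (Σ lam : Irreps U, Fin (mult U lam)) → Circle) :
    B.torus z ∈ symUnitaries U := B.unitaryOfBlocks_mem _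

theorem block_torus (z : (Σ lam : Irreps U, Fin (mult U lam)) → Circle) (lam : Irreps U) :
    B.block lam (B.torus z) = Matrix.diagonal fun i => (z ⟨lam, i⟩ : ℂ) :=
  B.block_unitaryOfBlocks _ lam

theorem torus_vec (z : (Σ lam : Irreps U, Fin (mult U lam)) → Circle) (lam : Irreps U)
    (a : Fin (B.dim lam)) (i : Fin (mult U lam)) :
    (B.torus z : H →L[ℂ] H) (B.vec ⟨lam, a, i⟩) = (z ⟨lam, i⟩ : ℂ) • B.vec ⟨lam, a, i⟩ := by
  rw [B.apply_vec (isInvariant_of_mem (B.torus_mem z)), block_torus,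
    Finset.sum_eq_single i]
  · rw [Matrix.diagonal_apply_eq]
  · intro j _ hj
    rw [Matrix.diagonal_apply_ne _ hj, zero_smul]
  · simp

theorem torus_mul (z w : (Σ lam : Irreps U, Fin (mult U lam)) → Circle) :
    B.torus (z * w) = B.torus z * B.torus w := by
  refine B.ext_unitary (B.torus_mem _) (mul_mem (B.torus_mem _) (B.torus_mem _)) fun lam => ?_
  rw [B.block_coe_mul lam (B.torus_mem _), block_torus, block_torus, block_torus,
    Matrix.diagonal_mul_diagonal]
  simp

/-- Every element of `𝒱^G` is conjugate in `𝒱^G` to an element of the maximal torus. -/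
theorem exists_torus_conj {V : unitary (H →L[ℂ] H)} (hV : V ∈ symUnitaries U) :
    ∃ g ∈ symUnitaries U, ∃ z, V = g * B.torus z * g⁻¹ := by
  choose g hg z hz hdiag using fun lam =>
    exists_unitary_diagonalization (B.block_mem_unitary lam hV)
  let c : ∀ lam, unitary (Matrix (Fin (mult U lam)) (Fin (mult U lam)) ℂ) :=
    fun lam => ⟨g lam, hg lam⟩
  have hc := B.unitaryOfBlocks_mem c
  choose w hw using fun x : (Σ lam : Irreps U, Fin (mult U lam)) =>
    (⟨⟨z x.1 x.2, mem_sphere_zero_iff_norm.2 (hz x.1 x.2)⟩, rfl⟩ :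
      ∃ w : Circle, (w : ℂ) = z x.1 x.2)
  refine ⟨B.unitaryOfBlocks c, hc, w, ?_⟩
  refine B.ext_unitary hV (mul_mem (mul_mem hc (B.torus_mem _)) (inv_mem hc)) fun lam => ?_
  rw [B.block_coe_mul lam (inv_mem hc), B.block_coe_mul lam (B.torus_mem _), block_coe_inv,
    block_torus, block_unitaryOfBlocks, hdiag]
  simp only [hw]
  rfl

theorem permMatrix_mem_unitary {n : Type*} [Fintype n] [DecidableEq n] (σ : Equiv.Perm n) :
    σ.permMatrix ℂ ∈ unitary (Matrix n n ℂ) := by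
  refine Unitary.mem_iff.2 ⟨?_, ?_⟩ <;>
  · rw [Matrix.star_eq_conjTranspose, Matrix.conjTranspose_permMatrix, ← Matrix.permMatrix_mul]
    simp

/-- The point of the torus with phase `w` at the coordinate `x` and `1` elsewhere. -/
def phaseAt (x : Σ lam : Irreps U, Fin (mult U lam)) (w : Circle) :
    (Σ lam : Irreps U, Fin (mult U lam)) → Circle :=
  fun y => if y = x then w else 1

/-- Moving a phase from one vector of a multiplicity space to another one is a commutator of
invariant unitaries. -/
theorem torus_swap_mem (lam : Irreps U) (i j : Fin (mult U lam)) (w : Circle) :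
    B.torus (phaseAt ⟨lam, i⟩ w * phaseAt ⟨lam, j⟩ w⁻¹) ∈ commSymUnitaries U := by
  let σ : ∀ mu, Equiv.Perm (Fin (mult U mu)) := Function.update 1 lam (Equiv.swap i j)
  let P : unitary (H →L[ℂ] H) := B.unitaryOfBlocks fun mu => ⟨_, permMatrix_mem_unitary (σ mu)⟩
  have hP : P ∈ symUnitaries U := B.unitaryOfBlocks_mem _
  have hPb : ∀ mu, B.block mu P = (σ mu).permMatrix ℂ := fun mu => B.block_unitaryOfBlocks _ mu
  -- the permutation `P` exchanges the coordinates `i` and `j` of the torus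
  have hconj : P * B.torus (phaseAt ⟨lam, i⟩ w) = B.torus (phaseAt ⟨lam, j⟩ w) * P := by
    refine B.ext_unitary (mul_mem hP (B.torus_mem _)) (mul_mem (B.torus_mem _) hP) fun mu => ?_
    rw [B.block_coe_mul mu hP, B.block_coe_mul mu (B.torus_mem _), hPb, block_torus, block_torus,
      Equiv.Perm.permMatrix, PEquiv.toMatrix_toPEquiv_mul, PEquiv.mul_toMatrix_toPEquiv]
    ext k l
    simp only [Matrix.submatrix_apply, id, Matrix.diagonal_apply, phaseAt]
    by_cases h : mu = lam
    · subst h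
      have h0 : σ mu = Equiv.swap i j := Function.update_self ..
      rw [h0, Equiv.symm_swap]
      have h1 : Equiv.swap i j k = l ↔ k = Equiv.swap i j l :=
        ⟨fun h => by rw [← h, Equiv.swap_apply_self], fun h => by rw [h, Equiv.swap_apply_self]⟩
      have h2 : Equiv.swap i j k = i ↔ k = j :=
        ⟨fun h => by rw [← Equiv.swap_apply_self i j k, h, Equiv.swap_apply_left],
          fun h => by rw [h, Equiv.swap_apply_right]⟩
      simp only [h1, Sigma.mk.injEq, heq_eq_eq, true_and, h2]
    · have h0 : σ mu = 1 := Function.update_of_ne h ..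
      have h1 : ∀ (r : Fin (mult U lam)) (s : Fin (mult U mu)),
          ¬ ((⟨mu, s⟩ : Σ lam : Irreps U, Fin (mult U lam)) = ⟨lam, r⟩) :=
        fun r s h4 => h (congrArg Sigma.fst h4)
      simp only [h0, h1, if_false]
      rfl
  have h1 : B.torus (phaseAt ⟨lam, j⟩ w⁻¹) = (B.torus (phaseAt ⟨lam, j⟩ w))⁻¹ := by
    rw [eq_inv_iff_mul_eq_one, ← torus_mul]
    refine B.ext_unitary (B.torus_mem _) (one_mem _) fun mu => ?_
    have h2 : phaseAt (⟨lam, j⟩ : Σ lam : Irreps U, Fin (mult U lam)) w⁻¹ * phaseAt ⟨lam, j⟩ w =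
        1 := by
      funext y
      by_cases hy : y = ⟨lam, j⟩ <;> simp [phaseAt, hy]
    rw [h2, block_torus]
    simp [block_one]
  have h2 : B.torus (phaseAt ⟨lam, i⟩ w * phaseAt ⟨lam, j⟩ w⁻¹) =
      ⁅B.torus (phaseAt ⟨lam, i⟩ w), P⁆ := by
    have h3 : P * (B.torus (phaseAt ⟨lam, i⟩ w))⁻¹ = (B.torus (phaseAt ⟨lam, j⟩ w))⁻¹ * P := by
      rw [mul_inv_eq_iff_eq_mul, mul_assoc, hconj, inv_mul_cancel_left]
    rw [torus_mul, h1, commutatorElement_def, mul_assoc (B.torus (phaseAt ⟨lam, i⟩ w)), h3,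
      mul_assoc, mul_assoc, mul_inv_cancel, mul_one]
  rw [h2]
  exact Subgroup.commutator_mem_commutator (B.torus_mem _) hP

/-! ### Characters of the group of invariant unitaries -/

/-- The character `∏_λ (det V_λ)^{q(λ)}` of `𝒱^G`. -/
def detChar (q : Irreps U → ℤ) (V : H →L[ℂ] H) : ℂ := ∏ lam, (B.block lam V).det ^ q lam

theorem norm_det_block (lam : Irreps U) {V : unitary (H →L[ℂ] H)} (hV : V ∈ symUnitaries U) :
    ‖(B.block lam V).det‖ = 1 := by
  have := Matrix.det_of_mem_unitary (B.block_mem_unitary lam hV)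
  exact CStarRing.norm_of_mem_unitary this

theorem detChar_mul (q : Irreps U → ℤ) {V W : unitary (H →L[ℂ] H)}
    (hW : W ∈ symUnitaries U) :
    B.detChar q (V * W : unitary (H →L[ℂ] H)) = B.detChar q V * B.detChar q W := by
  simp only [detChar, B.block_coe_mul _ hW, Matrix.det_mul, mul_zpow, Finset.prod_mul_distrib]

theorem detChar_one (q : Irreps U → ℤ) :
    B.detChar q (1 : unitary (H →L[ℂ] H)) = 1 := by
  simp [detChar, block_one]

theorem detChar_conj (q : Irreps U → ℤ) {V g : unitary (H →L[ℂ] H)} (hV : V ∈ symUnitaries U)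
    (hg : g ∈ symUnitaries U) :
    B.detChar q (g * V * g⁻¹ : unitary (H →L[ℂ] H)) = B.detChar q V := by
  have h1 := B.detChar_mul q (V := g) (inv_mem hg)
  rw [mul_inv_cancel, detChar_one] at h1
  rw [B.detChar_mul q (inv_mem hg), B.detChar_mul q hV]
  linear_combination -B.detChar q V * h1

theorem detChar_torus (q : Irreps U → ℤ) (z : (Σ lam : Irreps U, Fin (mult U lam)) → Circle) :
    B.detChar q (B.torus z) = ∏ lam, (∏ i, (z ⟨lam, i⟩ : ℂ)) ^ q lam := by
  simp [detChar, block_torus, Matrix.det_diagonal]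

/-! ### Exponentials of invariant Hermitian operators -/

theorem block_pow (lam : Irreps U) {A : H →L[ℂ] H} (hA : IsInvariant U A) (k : ℕ) :
    B.block lam (A ^ k) = B.block lam A ^ k := by
  induction k with
  | zero => simp [block_one]
  | succ k ih => rw [pow_succ, B.block_mul lam _ hA, ih, pow_succ]

theorem continuous_block (lam : Irreps U) : Continuous (B.block lam) := by
  refine continuous_matrix fun i j => ?_
  simp only [block, Matrix.of_apply]
  fun_prop

/-- Taking blocks is multiplicative on invariant operators, hence commutes with the exponential. -/
theorem block_exp (lam : Irreps U) {A : H →L[ℂ] H} (hA : IsInvariant U A) :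
    B.block lam (NormedSpace.exp A) = NormedSpace.exp (B.block lam A) := by
  let f : (H →L[ℂ] H) →+ Matrix (Fin (mult U lam)) (Fin (mult U lam)) ℂ :=
    AddMonoidHom.mk' (B.block lam) (B.block_add lam)
  have h := (NormedSpace.exp_series_hasSum_exp' (𝕂 := ℂ) A).map f (B.continuous_block lam)
  rw [congrFun (NormedSpace.exp_eq_tsum ℂ) (B.block lam A)]
  refine (h.tsum_eq.symm.trans ?_)
  refine tsum_congr fun k => ?_
  exact (B.block_smul lam _ _).trans (by rw [B.block_pow lam hA])

theorem det_exp_smul_of_isHermitian {n : Type*} [Fintype n] [DecidableEq n] {A : Matrix n n ℂ}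
    (hA : A.IsHermitian) (c : ℂ) :
    (NormedSpace.exp (c • A)).det = Complex.exp (c * A.trace) := by
  obtain ⟨g, hg, d, rfl⟩ := exists_hermitian_diagonalization hA
  have hgs : star g * g = 1 := (Unitary.mem_iff.1 hg).1
  have hgs' : g * star g = 1 := (Unitary.mem_iff.1 hg).2
  have hinv : star g = g⁻¹ := (Matrix.inv_eq_left_inv hgs).symm
  have hu : IsUnit g := ⟨⟨g, star g, hgs', hgs⟩, rfl⟩
  have h1 : c • (g * Matrix.diagonal (fun i => (d i : ℂ)) * star g) =
      g * Matrix.diagonal (fun i => c * (d i : ℂ)) * g⁻¹ := by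
    rw [← hinv, ← smul_mul_assoc, ← mul_smul_comm]
    congr 2
    ext i j
    by_cases h : i = j
    · subst h; simp
    · simp [h]
  rw [h1, Matrix.exp_conj _ _ hu, Matrix.exp_diagonal, Matrix.det_mul, Matrix.det_mul,
    Matrix.det_diagonal, Matrix.trace_mul_cycle, hgs, one_mul, Matrix.trace_diagonal,
    mul_right_comm, ← Matrix.det_mul, ← hinv, hgs', Matrix.det_one, one_mul, Finset.mul_sum,
    Complex.exp_sum]
  refine Finset.prod_congr rfl fun i _ => ?_
  rw [Pi.coe_exp, Complex.exp_eq_exp_ℂ]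

theorem detChar_exp (q : Irreps U → ℤ) {A : H →L[ℂ] H} (hA : IsInvariant U A)
    (hsa : IsSelfAdjoint A) (c : ℂ) :
    B.detChar q (NormedSpace.exp (c • A)) =
      Complex.exp (c * ∑ lam, q lam * (B.block lam A).trace) := by
  have hc : IsInvariant U (c • A) := fun g => (hA g).smul_left c
  have hb : ∀ lam, (B.block lam A).IsHermitian := fun lam => by
    change star _ = _
    rw [← block_star, hsa.star_eq]
  rw [detChar, Finset.mul_sum, Complex.exp_sum]
  refine Finset.prod_congr rfl fun lam _ => ?_
  rw [B.block_exp lam hc, block_smul, det_exp_smul_of_isHermitian (hb lam), ← Complex.exp_int_mul]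
  ring_nf

variable {ι : Type*} {Ham : ι → H →L[ℂ] H}

theorem _root_.SymDesign.generatedGroup_le (hinv : ∀ l, IsInvariant U (Ham l)) :
    generatedGroup Ham ≤ symUnitaries U := by
  refine (Subgroup.closure_le _).2 ?_
  rintro V ⟨l, t, hV⟩
  refine mem_symUnitaries_of_isInvariant fun g => ?_
  rw [hV]
  exact ((hinv l g).smul_left _).exp_left

/-- A character of `𝒱^G` is trivial on the group generated by the Hamiltonians if and only if its
differential vanishes on them. -/
theorem detChar_generatedGroup_iff (hinv : ∀ l, IsInvariant U (Ham l))
    (hsa : ∀ l, IsSelfAdjoint (Ham l)) (q : Irreps U → ℤ) :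
    (∀ V ∈ generatedGroup Ham, B.detChar q (V : H →L[ℂ] H) = 1) ↔
      ∀ l, ∑ lam, q lam * (B.block lam (Ham l)).trace = 0 := by
  constructor
  · intro h l
    set s := ∑ lam, q lam * (B.block lam (Ham l)).trace with hs
    have h1 : ∀ t : ℝ, Complex.exp (-Complex.I * (t : ℂ) * s) = 1 := fun t => by
      have hmem : NormedSpace.exp ((-Complex.I * (t : ℂ)) • Ham l) ∈ unitary (H →L[ℂ] H) := by
        let := NormedAlgebra.restrictScalars ℚ ℂ (H →L[ℂ] H)
        refine NormedSpace.exp_mem_unitary_of_mem_skewAdjoint ?_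
        rw [skewAdjoint.mem_iff, star_smul, (hsa l).star_eq, ← neg_smul]
        simp
      have h2 := h ⟨_, hmem⟩ (Subgroup.subset_closure ⟨l, t, rfl⟩)
      rwa [B.detChar_exp q (hinv l) (hsa l)] at h2
    have h2 : HasDerivAt (fun t : ℝ => Complex.exp (-Complex.I * (t : ℂ) * s))
        (Complex.exp (-Complex.I * ((0 : ℝ) : ℂ) * s) * (-Complex.I * 1 * s)) 0 :=
      (((Complex.ofRealCLM.hasDerivAt (x := (0 : ℝ))).const_mul (-Complex.I)).mul_const s).cexp
    have h3 : HasDerivAt (fun t : ℝ => Complex.exp (-Complex.I * (t : ℂ) * s)) 0 0 := by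
      simp only [h1]
      exact hasDerivAt_const _ _
    simpa using h2.unique h3
  · intro h V hV
    have hle := generatedGroup_le hinv
    induction hV using Subgroup.closure_induction with
    | mem V hV =>
      obtain ⟨l, t, hV⟩ := hV
      rw [hV, B.detChar_exp q (hinv l) (hsa l), h, mul_zero, Complex.exp_zero]
    | one => exact B.detChar_one q
    | mul V W hV hW h1 h2 => rw [B.detChar_mul q (hle hW), h1, h2, mul_one]
    | inv V hV h1 =>
      have h2 := B.detChar_mul q (V := V) (inv_mem (hle hV))
      rw [mul_inv_cancel, detChar_one, h1, one_mul] at h2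
      exact h2.symm

end AdaptedBasis
end Torus

/-! ### Uniform distributions on compact groups of unitaries -/

section Haar
variable {H : Type*} [NormedAddCommGroup H] [InnerProductSpace ℂ H] [FiniteDimensional ℂ H]
  [CompleteSpace H]

instance isProbabilityMeasure_haarMeasure_top {K : Type*} [Group K] [TopologicalSpace K]
    [IsTopologicalGroup K] [CompactSpace K] [MeasurableSpace K] [BorelSpace K] :
    IsProbabilityMeasure (Measure.haarMeasure (⊤ : TopologicalSpace.PositiveCompacts K)) :=
  ⟨Measure.haarMeasure_self (K₀ := (⊤ : TopologicalSpace.PositiveCompacts K))⟩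

/-- A compact group is unimodular. -/
instance isMulRightInvariant_haarMeasure_top {K : Type*} [Group K] [TopologicalSpace K]
    [IsTopologicalGroup K] [CompactSpace K] [MeasurableSpace K] [BorelSpace K] :
    (Measure.haarMeasure (⊤ : TopologicalSpace.PositiveCompacts K)).IsMulRightInvariant := by
  refine ⟨fun g => ?_⟩
  have : IsProbabilityMeasure
      ((Measure.haarMeasure (⊤ : TopologicalSpace.PositiveCompacts K)).map (· * g)) :=
    Measure.isProbabilityMeasure_map (measurable_mul_const g).aemeasurable
  exact Measure.isHaarMeasure_eq_of_isProbabilityMeasure _ _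

variable (K : Subgroup (unitary (H →L[ℂ] H))) [CompactSpace K]

instance isProbabilityMeasure_uniformDist : IsProbabilityMeasure (uniformDist K) :=
  Measure.isProbabilityMeasure_map measurable_subtype_coe.aemeasurable

theorem integral_uniformDist {f : unitary (H →L[ℂ] H) → ℂ} (hf : Continuous f) :
    ∫ V, f V ∂uniformDist K =
      ∫ V : K, f V ∂Measure.haarMeasure (⊤ : TopologicalSpace.PositiveCompacts K) :=
  integral_map measurable_subtype_coe.aemeasurable hf.aestronglyMeasurable

variable {K}

theorem integral_uniformDist_congr {f f' : unitary (H →L[ℂ] H) → ℂ} (hf : Continuous f)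
    (hf' : Continuous f') (h : ∀ V ∈ K, f V = f' V) :
    ∫ V, f V ∂uniformDist K = ∫ V, f' V ∂uniformDist K := by
  rw [integral_uniformDist K hf, integral_uniformDist K hf']
  exact integral_congr_ae (Filter.Eventually.of_forall fun V => h V V.2)

theorem integral_uniformDist_mul_left {f : unitary (H →L[ℂ] H) → ℂ} (hf : Continuous f)
    {W : unitary (H →L[ℂ] H)} (hW : W ∈ K) :
    ∫ V, f (W * V) ∂uniformDist K = ∫ V, f V ∂uniformDist K := by
  rw [integral_uniformDist K hf, integral_uniformDist K (f := fun V => f (W * V)) (by fun_prop)]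
  exact integral_mul_left_eq_self (fun V : K => f V) (⟨W, hW⟩ : K)

theorem integral_uniformDist_mul_right {f : unitary (H →L[ℂ] H) → ℂ} (hf : Continuous f)
    {W : unitary (H →L[ℂ] H)} (hW : W ∈ K) :
    ∫ V, f (V * W) ∂uniformDist K = ∫ V, f V ∂uniformDist K := by
  rw [integral_uniformDist K hf, integral_uniformDist K (f := fun V => f (V * W)) (by fun_prop)]
  exact integral_mul_right_eq_self (fun V : K => f V) (⟨W, hW⟩ : K)

theorem isClosed_of_compactSpace (K : Subgroup (unitary (H →L[ℂ] H))) [CompactSpace K] :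
    IsClosed (K : Set (unitary (H →L[ℂ] H))) :=
  (isCompact_iff_compactSpace (s := (K : Set (unitary (H →L[ℂ] H)))).2 inferInstance).isClosed

/-- A compact group is determined by its uniform distribution: it is its support. -/
theorem le_of_uniformDist_eq {K K' : Subgroup (unitary (H →L[ℂ] H))} [CompactSpace K]
    [CompactSpace K'] (h : uniformDist K = uniformDist K') : K ≤ K' := by
  have hc := isClosed_of_compactSpace K'
  have h0 : uniformDist K' (K' : Set (unitary (H →L[ℂ] H)))ᶜ = 0 := by
    rw [uniformDist, Measure.map_apply measurable_subtype_coe hc.measurableSet.compl]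
    have : (Subtype.val : K' → unitary (H →L[ℂ] H)) ⁻¹' (K' : Set (unitary (H →L[ℂ] H)))ᶜ = ∅ := by
      ext V; simp
    rw [this, measure_empty]
  rw [← h, uniformDist, Measure.map_apply measurable_subtype_coe hc.measurableSet.compl] at h0
  have ho : IsOpen ((Subtype.val : K → unitary (H →L[ℂ] H)) ⁻¹'
      (K' : Set (unitary (H →L[ℂ] H)))ᶜ) := hc.isOpen_compl.preimage continuous_subtype_val
  have he := (ho.measure_eq_zero_iff _).1 h0
  intro V hV
  by_contra hV'
  exact Set.eq_empty_iff_forall_notMem.1 he ⟨V, hV⟩ hV'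

end Haar

/-! ### Polynomials on the unitary group -/

section Polynomials
variable {H : Type*} [NormedAddCommGroup H] [InnerProductSpace ℂ H] [FiniteDimensional ℂ H]
  [CompleteSpace H]

/-- The functions on the unitary group that are restrictions of linear forms. -/
def linForms (H : Type*) [NormedAddCommGroup H] [InnerProductSpace ℂ H] [FiniteDimensional ℂ H]
    [CompleteSpace H] : Submodule ℂ (unitary (H →L[ℂ] H) → ℂ) where
  carrier := {f | ∃ φ : (H →L[ℂ] H) →ₗ[ℂ] ℂ, ∀ V, f V = φ V}
  add_mem' := by
    rintro f f' ⟨φ, hφ⟩ ⟨φ', hφ'⟩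
    exact ⟨φ + φ', fun V => by simp [hφ, hφ']⟩
  zero_mem' := ⟨0, fun V => by simp⟩
  smul_mem' := by
    rintro c f ⟨φ, hφ⟩
    exact ⟨c • φ, fun V => by simp [hφ]⟩

/-- The complex conjugates of the restrictions of linear forms. -/
def conjForms (H : Type*) [NormedAddCommGroup H] [InnerProductSpace ℂ H] [FiniteDimensional ℂ H]
    [CompleteSpace H] : Submodule ℂ (unitary (H →L[ℂ] H) → ℂ) where
  carrier := {f | star f ∈ linForms H}
  add_mem' := by
    intro f f' hf hf'
    rw [Set.mem_ofPred_eq, star_add]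
    exact add_mem hf hf'
  zero_mem' := by
    rw [Set.mem_ofPred_eq, star_zero]
    exact zero_mem _
  smul_mem' := by
    intro c f hf
    rw [Set.mem_ofPred_eq, star_smul]
    exact Submodule.smul_mem _ _ hf

/-- The functions on the unitary group given by polynomials that are homogeneous of degree `s` in
the matrix entries and homogeneous of degree `t` in their complex conjugates. -/
def polys (H : Type*) [NormedAddCommGroup H] [InnerProductSpace ℂ H] [FiniteDimensional ℂ H]
    [CompleteSpace H] (s t : ℕ) : Submodule ℂ (unitary (H →L[ℂ] H) → ℂ) :=
  linForms H ^ s * conjForms H ^ t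

theorem polys_mul_mem {s t s' t' : ℕ} {f f' : unitary (H →L[ℂ] H) → ℂ} (hf : f ∈ polys H s t)
    (hf' : f' ∈ polys H s' t') : f * f' ∈ polys H (s + s') (t + t') := by
  have h : polys H (s + s') (t + t') = polys H s t * polys H s' t' := by
    simp only [polys, pow_add]
    ring
  rw [h]
  exact Submodule.mul_mem_mul hf hf'

theorem one_mem_polys_zero : (1 : unitary (H →L[ℂ] H) → ℂ) ∈ polys H 0 0 := by
  rw [polys, pow_zero, pow_zero, one_mul]
  exact Submodule.one_le.1 le_rfl

theorem linForms_le_polys : linForms H ≤ polys H 1 0 := by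
  rw [polys, pow_zero, pow_one, mul_one]

variable {κ : Type*} [Fintype κ] [DecidableEq κ] (b : OrthonormalBasis κ ℂ H)

/-- A matrix entry, as a function on the unitary group. -/
def entry (ij : κ × κ) : unitary (H →L[ℂ] H) → ℂ := fun V =>
  LinearMap.toMatrix b.toBasis b.toBasis ((V : H →L[ℂ] H) : H →ₗ[ℂ] H) ij.1 ij.2

theorem linForms_eq_span : linForms H = Submodule.span ℂ (Set.range (entry b)) := by
  apply le_antisymm
  · rintro f ⟨φ, hφ⟩
    let E : κ → κ → (H →L[ℂ] H) := fun i j => LinearMap.toContinuousLinearMap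
      (Matrix.toLin b.toBasis b.toBasis (Matrix.single i j 1))
    have h : f = ∑ i, ∑ j, φ (E i j) • entry b (i, j) := by
      funext V
      have h1 : (V : H →L[ℂ] H) = ∑ i, ∑ j, entry b (i, j) V • E i j := by
        apply ContinuousLinearMap.coe_injective
        have h2 := Matrix.toLin_toMatrix b.toBasis b.toBasis ((V : H →L[ℂ] H) : H →ₗ[ℂ] H)
        rw [Matrix.matrix_eq_sum_single (LinearMap.toMatrix b.toBasis b.toBasis
          ((V : H →L[ℂ] H) : H →ₗ[ℂ] H))] at h2
        rw [← h2, map_sum]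
        simp only [ContinuousLinearMap.toLinearMap_sum]
        refine Finset.sum_congr rfl fun i _ => ?_
        rw [map_sum]
        refine Finset.sum_congr rfl fun j _ => ?_
        have h3 : Matrix.single i j (LinearMap.toMatrix b.toBasis b.toBasis
            ((V : H →L[ℂ] H) : H →ₗ[ℂ] H) i j) = entry b (i, j) V • Matrix.single i j (1 : ℂ) := by
          rw [Matrix.smul_single, smul_eq_mul, mul_one]; rfl
        rw [h3, map_smul]
        rfl
      rw [hφ, h1]
      simp [mul_comm]
    rw [h]
    exact Submodule.sum_mem _ fun i _ => Submodule.sum_mem _ fun j _ =>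
      Submodule.smul_mem _ _ (Submodule.subset_span ⟨(i, j), rfl⟩)
  · refine Submodule.span_le.2 ?_
    rintro _ ⟨ij, rfl⟩
    exact ⟨(Matrix.entryLinearMap ℂ ℂ ij.1 ij.2) ∘ₗ
      (LinearMap.toMatrix b.toBasis b.toBasis).toLinearMap ∘ₗ
        (ContinuousLinearMap.coeLM ℂ), fun V => rfl⟩

theorem conjForms_eq_span :
    conjForms H = Submodule.span ℂ (Set.range fun ij => star (entry b ij)) := by
  apply le_antisymm
  · intro f hf
    have hf' : star f ∈ linForms H := hf
    rw [linForms_eq_span b] at hf'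
    have h : ∀ g ∈ Submodule.span ℂ (Set.range (entry b)),
        star g ∈ Submodule.span ℂ (Set.range fun ij => star (entry b ij)) := by
      intro g hg
      induction hg using Submodule.span_induction with
      | mem x hx =>
        obtain ⟨ij, rfl⟩ := hx
        exact Submodule.subset_span ⟨ij, rfl⟩
      | zero => rw [star_zero]; exact zero_mem _
      | add x y _ _ hx hy => rw [star_add]; exact add_mem hx hy
      | smul c x _ hx => rw [star_smul]; exact Submodule.smul_mem _ _ hx
    have := h _ hf'
    rwa [star_star] at this
  · refine Submodule.span_le.2 ?_
    rintro _ ⟨ij, rfl⟩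
    change star (star (entry b ij)) ∈ linForms H
    rw [star_star, linForms_eq_span b]
    exact Submodule.subset_span ⟨ij, rfl⟩

/-- `V^{⊗ s} ⊗ (V*)^{⊗ t}` in the orthonormal basis `b`; the moment matrix is the case `s = t`.
Unequal `s` and `t` are needed in order to separate measures by polynomials. -/
def genMoment (s t : ℕ) (V : H →L[ℂ] H) :
    Matrix ((Fin s → κ) × (Fin t → κ)) ((Fin s → κ) × (Fin t → κ)) ℂ :=
  tensorPow s (LinearMap.toMatrix b.toBasis b.toBasis (V : H →ₗ[ℂ] H)) ⊗ₖ
    tensorPow t ((LinearMap.toMatrix b.toBasis b.toBasis (V : H →ₗ[ℂ] H)).map (starRingEnd ℂ))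

theorem genMoment_apply (s t : ℕ) (V : unitary (H →L[ℂ] H)) (i j) :
    genMoment b s t V i j =
      (∏ a, entry b (i.1 a, j.1 a) V) * ∏ a, star (entry b (i.2 a, j.2 a)) V := rfl

theorem polys_eq_span (s t : ℕ) : polys H s t = Submodule.span ℂ
    (Set.range fun (ij : ((Fin s → κ) × (Fin t → κ)) × ((Fin s → κ) × (Fin t → κ)))
      (V : unitary (H →L[ℂ] H)) => genMoment b s t V ij.1 ij.2) := by
  rw [polys, linForms_eq_span b, conjForms_eq_span b, Submodule.span_pow, Submodule.span_pow,
    Submodule.span_mul_span]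
  congr 1
  ext f
  rw [Set.mem_mul]
  constructor
  · rintro ⟨f, hf, f', hf', rfl⟩
    obtain ⟨u, rfl⟩ := Set.mem_pow.1 hf
    obtain ⟨u', rfl⟩ := Set.mem_pow.1 hf'
    choose x hx using fun k => (u k).2
    choose x' hx' using fun k => (u' k).2
    refine ⟨((fun k => (x k).1, fun k => (x' k).1), (fun k => (x k).2, fun k => (x' k).2)), ?_⟩
    funext V
    refine (genMoment_apply b s t V _ _).trans ?_
    rw [Pi.mul_apply, List.prod_ofFn, List.prod_ofFn, Finset.prod_apply, Finset.prod_apply]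
    simp only [← hx, ← hx']
  · rintro ⟨⟨i, j⟩, rfl⟩
    refine ⟨_, Set.mem_pow.2 ⟨fun k => ⟨entry b (i.1 k, j.1 k), _, rfl⟩, rfl⟩, _,
      Set.mem_pow.2 ⟨fun k => ⟨star (entry b (i.2 k, j.2 k)), _, rfl⟩, rfl⟩, ?_⟩
    funext V
    refine Eq.trans ?_ (genMoment_apply b s t V i j).symm
    rw [Pi.mul_apply, List.prod_ofFn, List.prod_ofFn, Finset.prod_apply, Finset.prod_apply]

theorem continuous_of_mem_linForms {f : unitary (H →L[ℂ] H) → ℂ} (hf : f ∈ linForms H) :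
    Continuous f := by
  obtain ⟨φ, hφ⟩ := hf
  have h : f = fun V : unitary (H →L[ℂ] H) => φ V := funext hφ
  rw [h]
  exact (LinearMap.continuous_of_finiteDimensional φ).comp continuous_subtype_val

theorem continuous_entry (ij : κ × κ) : Continuous (entry b ij) := by
  refine continuous_of_mem_linForms ?_
  rw [linForms_eq_span b]
  exact Submodule.subset_span ⟨ij, rfl⟩

theorem continuous_genMoment (s t : ℕ) (i j) :
    Continuous fun V : unitary (H →L[ℂ] H) => genMoment b s t V i j := by
  simp only [genMoment_apply]
  refine Continuous.mul (continuous_finsetProd _ fun a _ => continuous_entry b _)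
    (continuous_finsetProd _ fun a _ => (continuous_entry b _).star)

theorem integrable_of_continuous {f : unitary (H →L[ℂ] H) → ℂ} (hf : Continuous f)
    (μ : Measure (unitary (H →L[ℂ] H))) [IsFiniteMeasure μ] : Integrable f μ :=
  hf.integrable_of_hasCompactSupport (HasCompactSupport.of_compactSpace f)

theorem continuous_of_mem_polys {s t : ℕ} {f : unitary (H →L[ℂ] H) → ℂ} (hf : f ∈ polys H s t) :
    Continuous f := by
  rw [polys_eq_span (stdOrthonormalBasis ℂ H)] at hf
  induction hf using Submodule.span_induction with
  | mem x hx =>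
    obtain ⟨⟨i, j⟩, rfl⟩ := hx
    exact continuous_genMoment _ s t i j
  | zero => exact continuous_const
  | add x y _ _ hx hy => exact hx.add hy
  | smul c x _ hx => exact hx.const_smul c

/-- The two measures have the same integrals of all polynomials of bidegree `(s, t)`. -/
def Agree (s t : ℕ) (ν μ : Measure (unitary (H →L[ℂ] H))) : Prop :=
  ∀ f ∈ polys H s t, ∫ V, f V ∂ν = ∫ V, f V ∂μ

theorem agree_iff_genMoment (s t : ℕ) (ν μ : Measure (unitary (H →L[ℂ] H))) [IsFiniteMeasure ν]
    [IsFiniteMeasure μ] :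
    Agree s t ν μ ↔ ∀ i j, ∫ V, genMoment b s t (V : H →L[ℂ] H) i j ∂ν =
      ∫ V, genMoment b s t (V : H →L[ℂ] H) i j ∂μ := by
  constructor
  · intro h i j
    refine h _ ?_
    rw [polys_eq_span b]
    exact Submodule.subset_span ⟨(i, j), rfl⟩
  · intro h f hf
    have hf' := hf
    rw [polys_eq_span b] at hf'
    have : Continuous f ∧ ∫ V, f V ∂ν = ∫ V, f V ∂μ := by
      induction hf' using Submodule.span_induction with
      | mem x hx =>
        obtain ⟨⟨i, j⟩, rfl⟩ := hx
        exact ⟨continuous_genMoment b s t i j, h i j⟩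
      | zero => exact ⟨continuous_const, by simp⟩
      | add x y hx' hy' hx hy =>
        rw [← polys_eq_span b] at hx' hy'
        obtain ⟨hx1, hx2⟩ := hx hx'
        obtain ⟨hy1, hy2⟩ := hy hy'
        refine ⟨hx1.add hy1, ?_⟩
        simp only [Pi.add_apply]
        rw [integral_add (integrable_of_continuous hx1 _) (integrable_of_continuous hy1 _),
          integral_add (integrable_of_continuous hx1 _) (integrable_of_continuous hy1 _), hx2, hy2]
      | smul c x hx' hx =>
        rw [← polys_eq_span b] at hx'
        obtain ⟨hx1, hx2⟩ := hx hx'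
        refine ⟨hx1.const_smul c, ?_⟩
        simp only [Pi.smul_apply]
        rw [integral_smul, integral_smul, hx2]
    exact this.2

/-- Being a design does not depend on the orthonormal basis. -/
theorem isTDesign_iff_agree (t : ℕ) (ν μ : Measure (unitary (H →L[ℂ] H))) [IsFiniteMeasure ν]
    [IsFiniteMeasure μ] : IsTDesign b t ν μ ↔ Agree t t ν μ := by
  rw [agree_iff_genMoment b, IsTDesign, ← Matrix.ext_iff]
  rfl

end Polynomials

section Polynomials
variable {H : Type*} [NormedAddCommGroup H] [InnerProductSpace ℂ H] [FiniteDimensional ℂ H]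
  [CompleteSpace H]

theorem prod_mem_polys {α : Type*} (S : Finset α) {s t : α → ℕ}
    {f : α → unitary (H →L[ℂ] H) → ℂ} (hf : ∀ x ∈ S, f x ∈ polys H (s x) (t x)) :
    ∏ x ∈ S, f x ∈ polys H (∑ x ∈ S, s x) (∑ x ∈ S, t x) := by
  classical
  induction S using Finset.induction_on with
  | empty => simpa using one_mem_polys_zero
  | insert a S ha ih =>
    rw [Finset.prod_insert ha, Finset.sum_insert ha, Finset.sum_insert ha]
    exact polys_mul_mem (hf a (Finset.mem_insert_self a S))
      (ih fun x hx => hf x (Finset.mem_insert_of_mem hx))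

theorem pow_mem_polys {s t : ℕ} {f : unitary (H →L[ℂ] H) → ℂ} (hf : f ∈ polys H s t) (k : ℕ) :
    f ^ k ∈ polys H (k * s) (k * t) := by
  have := prod_mem_polys (Finset.range k) (s := fun _ => s) (t := fun _ => t) (f := fun _ => f)
    fun _ _ => hf
  simpa using this

theorem star_mem_polys {s t : ℕ} {f : unitary (H →L[ℂ] H) → ℂ} (hf : f ∈ polys H s t) :
    star f ∈ polys H t s := by
  let b := stdOrthonormalBasis ℂ H
  rw [polys_eq_span b] at hf
  induction hf using Submodule.span_induction with
  | mem x hx =>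
    obtain ⟨⟨i, j⟩, rfl⟩ := hx
    rw [polys_eq_span b]
    refine Submodule.subset_span ⟨(i.swap, j.swap), ?_⟩
    funext V
    refine (genMoment_apply b t s V _ _).trans ?_
    refine Eq.trans ?_ (congrArg star (genMoment_apply b s t V i j)).symm
    rw [star_mul', mul_comm]
    simp
  | zero => rw [star_zero]; exact zero_mem _
  | add x y _ _ hx hy => rw [star_add]; exact add_mem hx hy
  | smul c x _ hx => rw [star_smul]; exact Submodule.smul_mem _ _ hx

/-- The constants are polynomials of bidegree `(1, 1)`: a column of a unitary has norm one. -/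
theorem one_mem_polys_one [Nontrivial H] : (1 : unitary (H →L[ℂ] H) → ℂ) ∈ polys H 1 1 := by
  obtain ⟨v, hv⟩ := exists_norm_eq H (zero_le_one (α := ℝ))
  let b := stdOrthonormalBasis ℂ H
  let f : Fin (Module.finrank ℂ H) → unitary (H →L[ℂ] H) → ℂ :=
    fun i V => inner ℂ (b i) ((V : H →L[ℂ] H) v)
  have hf : ∀ i, f i ∈ linForms H := fun i => ⟨
    ((innerSL ℂ (b i)).comp (ContinuousLinearMap.apply ℂ H v)).toLinearMap, fun V => by simp [f]⟩
  have h : (1 : unitary (H →L[ℂ] H) → ℂ) = ∑ i, f i * star (f i) := by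
    funext V
    have h1 := b.sum_inner_mul_inner ((V : H →L[ℂ] H) v) ((V : H →L[ℂ] H) v)
    rw [inner_self_eq_norm_sq_to_K] at h1
    have h2 : ‖(V : H →L[ℂ] H) v‖ = 1 := by
      rw [ContinuousLinearMap.norm_map_of_mem_unitary V.2, hv]
    rw [h2] at h1
    rw [Finset.sum_apply, Pi.one_apply]
    refine Eq.symm (Eq.trans (Finset.sum_congr rfl fun i _ => ?_) (h1.trans (by simp)))
    rw [Pi.mul_apply, Pi.star_apply, mul_comm]
    congr 1
    exact inner_conj_symm _ _
  rw [h]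
  refine Submodule.sum_mem _ fun i _ => ?_
  have := polys_mul_mem (linForms_le_polys (hf i)) (star_mem_polys (linForms_le_polys (hf i)))
  simpa using this

/-- On the unitary group the bidegree can be raised, as `1` has bidegree `(1, 1)`. -/
theorem mem_polys_add [Nontrivial H] {s t : ℕ} {f : unitary (H →L[ℂ] H) → ℂ}
    (hf : f ∈ polys H s t) (k : ℕ) : f ∈ polys H (s + k) (t + k) := by
  have := polys_mul_mem hf (pow_mem_polys (one_mem_polys_one (H := H)) k)
  simpa using this

end Polynomials

theorem exists_circle_zpow_ne_one {k : ℤ} (hk : k ≠ 0) : ∃ w : Circle, w ^ k ≠ 1 := by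
  refine ⟨Circle.exp (Real.pi / k), fun h => ?_⟩
  have h1 : (k : ℝ) ≠ 0 := by exact_mod_cast hk
  rw [← Circle.exp_zsmul, zsmul_eq_mul, mul_div_cancel₀ _ h1] at h
  have h2 := congrArg (fun w : Circle => (w : ℂ)) h
  simp only [Circle.coe_exp, Complex.exp_pi_mul_I, Circle.coe_one] at h2
  norm_num at h2

/-! ### Characters as polynomials -/

namespace AdaptedBasis
variable {G : Type*} [Group G]
variable {H : Type*} [NormedAddCommGroup H] [InnerProductSpace ℂ H] [FiniteDimensional ℂ H]
  [CompleteSpace H]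
variable {U : G →* unitary (H →L[ℂ] H)} (B : AdaptedBasis U)

theorem det_block_mem_polys (lam : Irreps U) :
    (fun V : unitary (H →L[ℂ] H) => (B.block lam V).det) ∈ polys H (mult U lam) 0 := by
  have hlin : ∀ i j, (fun V : unitary (H →L[ℂ] H) => B.block lam V i j) ∈ linForms H :=
    fun i j => ⟨{ toFun := fun A => B.block lam A i j
                  map_add' := fun A A' => by rw [block_add, Matrix.add_apply]
                  map_smul' := fun c A => by rw [block_smul, Matrix.smul_apply]; rfl },
      fun V => rfl⟩
  have h : (fun V : unitary (H →L[ℂ] H) => (B.block lam V).det) =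
      ∑ σ : Equiv.Perm (Fin (mult U lam)), (Equiv.Perm.sign σ : ℂ) •
        ∏ i, fun V : unitary (H →L[ℂ] H) => B.block lam V (σ i) i := by
    funext V
    rw [Matrix.det_apply', Finset.sum_apply]
    refine Finset.sum_congr rfl fun σ _ => ?_
    rw [Pi.smul_apply, Finset.prod_apply, smul_eq_mul]
  rw [h]
  refine Submodule.sum_mem _ fun σ _ => Submodule.smul_mem _ _ ?_
  have := prod_mem_polys Finset.univ (s := fun _ => 1) (t := fun _ => 0)
    (f := fun i (V : unitary (H →L[ℂ] H)) => B.block lam V (σ i) i)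
    fun i _ => linForms_le_polys (hlin _ _)
  simpa using this

/-- On `𝒱^G`, the character `∏_λ (det V_λ)^{q(λ)}` is a polynomial in the entries of `V` and `V*`,
since there the inverse of `det V_λ` is its complex conjugate. -/
theorem exists_polys_eq_detChar (q : Irreps U → ℤ) :
    ∃ f ∈ polys H (∑ lam, (q lam).toNat * mult U lam) (∑ lam, (-q lam).toNat * mult U lam),
      ∀ V ∈ symUnitaries U, f V = B.detChar q (V : H →L[ℂ] H) := by
  let D : Irreps U → unitary (H →L[ℂ] H) → ℂ := fun lam V => (B.block lam V).det
  have hD : ∀ lam, D lam ∈ polys H (mult U lam) 0 := B.det_block_mem_polys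
  refine ⟨∏ lam, D lam ^ (q lam).toNat * star (D lam) ^ (-q lam).toNat,
    prod_mem_polys _ fun lam _ => ?_, fun V hV => ?_⟩
  · simpa using polys_mul_mem (pow_mem_polys (hD lam) (q lam).toNat)
      (pow_mem_polys (star_mem_polys (hD lam)) (-q lam).toNat)
  · rw [Finset.prod_apply, detChar]
    refine Finset.prod_congr rfl fun lam _ => ?_
    have hn : star (D lam V) = (D lam V)⁻¹ := by
      rw [Complex.star_def, Complex.inv_def, Complex.normSq_eq_norm_sq, B.norm_det_block lam hV]
      simp
    rw [Pi.mul_apply, Pi.pow_apply, Pi.pow_apply, Pi.star_apply, hn]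
    change D lam V ^ _ * _ = D lam V ^ q lam
    rcases le_total 0 (q lam) with h | h
    · rw [Int.toNat_of_nonpos (by omega : -q lam ≤ 0), pow_zero, mul_one, ← zpow_natCast,
        Int.toNat_of_nonneg h]
    · rw [Int.toNat_of_nonpos h, pow_zero, one_mul, ← zpow_natCast,
        Int.toNat_of_nonneg (by omega : 0 ≤ -q lam), inv_zpow, zpow_neg, inv_inv]

theorem exists_detChar_ne_one {q : Irreps U → ℤ} (hq : q ≠ 0) :
    ∃ V ∈ symUnitaries U, B.detChar q (V : H →L[ℂ] H) ≠ 1 := by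
  obtain ⟨lam, hlam⟩ := Function.ne_iff.1 hq
  obtain ⟨w, hw⟩ := exists_circle_zpow_ne_one hlam
  refine ⟨_, B.torus_mem (phaseAt ⟨lam, ⟨0, B.mult_pos lam⟩⟩ w), fun h => hw ?_⟩
  rw [detChar_torus, Finset.prod_eq_single lam, Finset.prod_eq_single ⟨0, B.mult_pos lam⟩] at h
  · rw [phaseAt, if_pos rfl] at h
    exact Circle.ext (by rw [Circle.coe_zpow, h, Circle.coe_one])
  · intro i _ hi
    rw [phaseAt, if_neg (by simpa using hi), Circle.coe_one]
  · simp
  · intro mu _ hmu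
    have : ∀ i : Fin (mult U mu), phaseAt (⟨lam, ⟨0, B.mult_pos lam⟩⟩ :
        Σ lam : Irreps U, Fin (mult U lam)) w ⟨mu, i⟩ = 1 := fun i =>
      if_neg fun h => hmu (congrArg Sigma.fst h)
    simp [this]
  · simp

/-- A character of `𝒱^G` of low degree that is trivial on a subgroup detects that the subgroup is
not a design: its average over the subgroup is `1`, but its average over `𝒱^G` is `0`. -/
theorem not_agree_of_detChar {W : Subgroup (unitary (H →L[ℂ] H))} [CompactSpace W]
    (hW : W ≤ symUnitaries U) {q : Irreps U → ℤ} (hq : q ≠ 0)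
    (hqW : ∀ V ∈ W, B.detChar q (V : H →L[ℂ] H) = 1) (h0 : ∑ lam, q lam * (mult U lam : ℤ) = 0)
    {t : ℕ} (ht : ∑ lam, |q lam| * (mult U lam : ℤ) ≤ 2 * t) :
    ¬ Agree t t (uniformDist W) (uniformDist (symUnitaries U)) := by
  intro hagree
  obtain ⟨lam, hlam⟩ := Function.ne_iff.1 hq
  have : Nontrivial H := ⟨B.vec ⟨lam, ⟨0, B.dim_pos lam⟩, ⟨0, B.mult_pos lam⟩⟩, 0,
    B.vec.orthonormal.ne_zero _⟩
  obtain ⟨f, hf, hfq⟩ := B.exists_polys_eq_detChar q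
  set s := ∑ lam, (q lam).toNat * mult U lam with hs
  set s' := ∑ lam, (-q lam).toNat * mult U lam with hs'
  have h1 : (s : ℤ) - s' = 0 := by
    rw [← h0, hs, hs']
    push_cast
    rw [← Finset.sum_sub_distrib]
    refine Finset.sum_congr rfl fun lam _ => ?_
    rw [← sub_mul]
    congr 1
    omega
  have h2 : (s : ℤ) + s' ≤ 2 * t := by
    refine le_trans (le_of_eq ?_) ht
    rw [hs, hs']
    push_cast
    rw [← Finset.sum_add_distrib]
    refine Finset.sum_congr rfl fun lam _ => ?_
    rw [← add_mul]
    congr 1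
    rcases abs_cases (q lam) with h | h <;> omega
  -- `f` has bidegree `(s, s)`, where `s` is half of `∑ |q(λ)| m_λ`; the constant `1`, of bidegree
  -- `(1, 1)`, raises it to `(t, t)`
  have hft : f ∈ polys H t t := by
    have := mem_polys_add hf (t - s)
    rwa [show s + (t - s) = t by omega, show s' + (t - s) = t by omega] at this
  have hfc := continuous_of_mem_polys hf
  have hintW : ∫ V, f V ∂uniformDist W = 1 := by
    rw [integral_uniformDist_congr hfc (f' := fun _ => 1) continuous_const
      fun V hV => (hfq V (hW hV)).trans (hqW V hV)]
    simp
  have hintK : ∫ V, f V ∂uniformDist (symUnitaries U) = 0 := by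
    obtain ⟨g, hg, hg1⟩ := B.exists_detChar_ne_one hq
    have h3 := integral_uniformDist_mul_left hfc hg
    rw [integral_uniformDist_congr (f' := fun V => B.detChar q (g : H →L[ℂ] H) * f V)
      (by fun_prop) (by fun_prop) fun V hV => by
        rw [hfq _ (mul_mem hg hV), hfq _ hV, B.detChar_mul q hV], integral_const_mul] at h3
    have h4 : (B.detChar q (g : H →L[ℂ] H) - 1) * ∫ V, f V ∂uniformDist (symUnitaries U) = 0 := by
      linear_combination h3
    exact (mul_eq_zero.1 h4).resolve_left (sub_ne_zero.2 hg1)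
  have := hagree f hft
  rw [hintW, hintK] at this
  exact one_ne_zero this

end AdaptedBasis

/-! ### Averages of moments over subgroups containing the commutators -/

section Moments
variable {κ : Type*} [Fintype κ] [DecidableEq κ]

theorem tensorPow_mul (t : ℕ) (A A' : Matrix κ κ ℂ) :
    tensorPow t (A * A') = tensorPow t A * tensorPow t A' := by
  ext i j
  simp only [tensorPow, Matrix.of_apply, Matrix.mul_apply, Finset.prod_univ_sum,
    Fintype.piFinset_univ, Finset.prod_mul_distrib]

theorem tensorPow_diagonal (t : ℕ) (d : κ → ℂ) :
    tensorPow t (Matrix.diagonal d) = Matrix.diagonal fun i => ∏ a, d (i a) := by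
  ext i j
  rw [tensorPow, Matrix.of_apply]
  by_cases h : i = j
  · subst h
    simp
  · obtain ⟨a, ha⟩ := Function.ne_iff.1 h
    rw [Matrix.diagonal_apply_ne _ h]
    exact Finset.prod_eq_zero (Finset.mem_univ a) (Matrix.diagonal_apply_ne _ ha)

variable {H : Type*} [NormedAddCommGroup H] [InnerProductSpace ℂ H] [FiniteDimensional ℂ H]
  [CompleteSpace H] (b : OrthonormalBasis κ ℂ H)

theorem genMoment_mul (s t : ℕ) (V V' : H →L[ℂ] H) :
    genMoment b s t (V * V') = genMoment b s t V * genMoment b s t V' := by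
  have h : LinearMap.toMatrix b.toBasis b.toBasis ((V * V' : H →L[ℂ] H) : H →ₗ[ℂ] H) =
      LinearMap.toMatrix b.toBasis b.toBasis (V : H →ₗ[ℂ] H) *
        LinearMap.toMatrix b.toBasis b.toBasis (V' : H →ₗ[ℂ] H) :=
    LinearMap.toMatrix_comp _ _ _ _ _
  rw [genMoment, h, Matrix.map_mul, tensorPow_mul, tensorPow_mul, Matrix.mul_kronecker_mul]
  rfl

theorem sum_mul_integral {α : Type*} [Fintype α] (μ : Measure (unitary (H →L[ℂ] H)))
    [IsFiniteMeasure μ] (c : α → ℂ) {f : α → unitary (H →L[ℂ] H) → ℂ}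
    (hf : ∀ k, Continuous (f k)) :
    ∑ k, c k * ∫ V, f k V ∂μ = ∫ V, ∑ k, c k * f k V ∂μ := by
  refine Eq.symm ((integral_finsetSum (f := fun k V => c k * f k V) _ fun k _ =>
    integrable_of_continuous (continuous_const.mul (hf k)) _).trans ?_)
  simp only [integral_const_mul]

theorem sum_integral_mul {α : Type*} [Fintype α] (μ : Measure (unitary (H →L[ℂ] H)))
    [IsFiniteMeasure μ] (c : α → ℂ) {f : α → unitary (H →L[ℂ] H) → ℂ}
    (hf : ∀ k, Continuous (f k)) :
    ∑ k, (∫ V, f k V ∂μ) * c k = ∫ V, ∑ k, f k V * c k ∂μ := by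
  simp only [mul_comm _ (c _)]
  exact sum_mul_integral μ c hf

end Moments

namespace AdaptedBasis
open scoped commutatorElement
variable {G : Type*} [Group G]
variable {H : Type*} [NormedAddCommGroup H] [InnerProductSpace ℂ H] [FiniteDimensional ℂ H]
  [CompleteSpace H]
variable {U : G →* unitary (H →L[ℂ] H)} (B : AdaptedBasis U)

/-- The coordinate of the maximal torus by which it acts on a vector of the adapted basis. -/
def coord (x : Σ lam : Irreps U, Fin (B.dim lam) × Fin (mult U lam)) :
    Σ lam : Irreps U, Fin (mult U lam) := ⟨x.1, x.2.2⟩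

/-- The weight of the maximal torus on a basis vector of `H^{⊗ s} ⊗ (H*)^{⊗ t}`. -/
def weight {s t : ℕ} (i : (Fin s → Σ lam : Irreps U, Fin (B.dim lam) × Fin (mult U lam)) ×
    (Fin t → Σ lam : Irreps U, Fin (B.dim lam) × Fin (mult U lam)))
    (x : Σ lam : Irreps U, Fin (mult U lam)) : ℤ :=
  (∑ a, if B.coord (i.1 a) = x then 1 else 0) - ∑ a, if B.coord (i.2 a) = x then 1 else 0

variable {s t : ℕ} (i : (Fin s → Σ lam : Irreps U, Fin (B.dim lam) × Fin (mult U lam)) ×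
    (Fin t → Σ lam : Irreps U, Fin (B.dim lam) × Fin (mult U lam)))

theorem sum_sum_ite_eq {J A : Type*} [Fintype J] [DecidableEq J] [Fintype A] (f : A → J) :
    ∑ x, ∑ a, (if f a = x then (1 : ℤ) else 0) = Fintype.card A := by
  rw [Finset.sum_comm]
  simp

theorem sum_weight : ∑ x, B.weight i x = s - t := by
  simp only [weight, Finset.sum_sub_distrib]
  rw [sum_sum_ite_eq, sum_sum_ite_eq, Fintype.card_fin, Fintype.card_fin]

theorem sum_abs_weight_le : ∑ x, |B.weight i x| ≤ s + t := by
  have h : ∀ x, |B.weight i x| ≤ (∑ a, if B.coord (i.1 a) = x then 1 else 0) +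
      ∑ a, if B.coord (i.2 a) = x then (1 : ℤ) else 0 := fun x => by
    have h1 : (0 : ℤ) ≤ ∑ a, if B.coord (i.1 a) = x then (1 : ℤ) else 0 :=
      Finset.sum_nonneg fun a _ => by split_ifs <;> simp
    have h2 : (0 : ℤ) ≤ ∑ a, if B.coord (i.2 a) = x then (1 : ℤ) else 0 :=
      Finset.sum_nonneg fun a _ => by split_ifs <;> simp
    rw [weight, abs_le]
    constructor <;> linarith
  refine (Finset.sum_le_sum fun x _ => h x).trans (le_of_eq ?_)
  rw [Finset.sum_add_distrib, sum_sum_ite_eq, sum_sum_ite_eq, Fintype.card_fin, Fintype.card_fin]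

theorem coe_circle_prod {A : Type*} (S : Finset A) (f : A → Circle) :
    ((∏ a ∈ S, f a : Circle) : ℂ) = ∏ a ∈ S, (f a : ℂ) := map_prod Circle.coeHom f S

theorem prod_zpow_ite_sum {J A : Type*} [Fintype J] [DecidableEq J] [Fintype A] (z : J → Circle)
    (f : A → J) : ∏ x, z x ^ (∑ a, if f a = x then (1 : ℤ) else 0) = ∏ a, z (f a) := by
  have h : ∀ x, z x ^ (∑ a, if f a = x then (1 : ℤ) else 0) =
      ∏ a, if f a = x then z x else 1 := fun x => by
    have h1 := map_sum (AddMonoidHom.mk' (fun k : ℤ => Additive.ofMul (z x ^ k))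
      (fun k l => by rw [zpow_add]; rfl)) (fun a => if f a = x then (1 : ℤ) else 0) Finset.univ
    have h2 : Additive.ofMul (z x ^ (∑ a, if f a = x then (1 : ℤ) else 0)) =
      Additive.ofMul (∏ a, z x ^ (if f a = x then (1 : ℤ) else 0)) := h1
    rw [Additive.ofMul.injective h2]
    refine Finset.prod_congr rfl fun a _ => ?_
    split_ifs <;> simp
  simp only [h]
  rw [Finset.prod_comm]
  simp

/-- The torus acts diagonally on `H^{⊗ s} ⊗ (H*)^{⊗ t}`, by the weights. -/
theorem genMoment_torus_mul (z : (Σ lam : Irreps U, Fin (mult U lam)) → Circle)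
    (M : Matrix ((Fin s → Σ lam : Irreps U, Fin (B.dim lam) × Fin (mult U lam)) ×
      (Fin t → Σ lam : Irreps U, Fin (B.dim lam) × Fin (mult U lam)))
      ((Fin s → Σ lam : Irreps U, Fin (B.dim lam) × Fin (mult U lam)) ×
      (Fin t → Σ lam : Irreps U, Fin (B.dim lam) × Fin (mult U lam))) ℂ) (j) :
    (genMoment B.vec s t (B.torus z : H →L[ℂ] H) * M) i j =
      ((∏ x, z x ^ B.weight i x : Circle) : ℂ) * M i j := by
  have h : LinearMap.toMatrix B.vec.toBasis B.vec.toBasis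
      ((B.torus z : H →L[ℂ] H) : H →ₗ[ℂ] H) = Matrix.diagonal fun x => (z (B.coord x) : ℂ) := by
    ext x y
    obtain ⟨lam, a, k⟩ := y
    rw [LinearMap.toMatrix_apply, OrthonormalBasis.coe_toBasis]
    change B.vec.toBasis.repr ((B.torus z : H →L[ℂ] H) (B.vec ⟨lam, a, k⟩)) x = _
    rw [torus_vec, map_smul, ← OrthonormalBasis.coe_toBasis, Module.Basis.repr_self,
      Finsupp.smul_apply, Matrix.diagonal_apply, Finsupp.single_apply]
    by_cases hx : x = ⟨lam, a, k⟩
    · subst hx; simp [coord]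
    · rw [if_neg hx, if_neg (Ne.symm hx)]; simp
  rw [genMoment, h, Matrix.diagonal_map (map_zero _), tensorPow_diagonal, tensorPow_diagonal,
    Matrix.diagonal_kronecker_diagonal, Matrix.diagonal_mul]
  congr 1
  simp only [weight, zpow_sub, Finset.prod_mul_distrib, Finset.prod_inv_distrib]
  rw [prod_zpow_ite_sum, prod_zpow_ite_sum, Circle.coe_mul, Circle.coe_inv_eq_conj,
    coe_circle_prod, coe_circle_prod, map_prod]

variable {W : Subgroup (unitary (H →L[ℂ] H))} [CompactSpace W]

/-- The average of a matrix representation over a subgroup is fixed by the subgroup. -/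
theorem genMoment_mul_average {κ : Type*} [Fintype κ] [DecidableEq κ] (b : OrthonormalBasis κ ℂ H)
    {V : unitary (H →L[ℂ] H)} (hV : V ∈ W) :
    (genMoment b s t (V : H →L[ℂ] H) * Matrix.of fun i j =>
      ∫ V, genMoment b s t (V : H →L[ℂ] H) i j ∂uniformDist W) =
      Matrix.of fun i j => ∫ V, genMoment b s t (V : H →L[ℂ] H) i j ∂uniformDist W := by
  ext i j
  rw [Matrix.mul_apply]
  refine (sum_mul_integral _ _ fun k => continuous_genMoment b s t k j).trans ?_
  rw [Matrix.of_apply, ← integral_uniformDist_mul_left (continuous_genMoment b s t i j) hV]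
  refine integral_congr_ae (Filter.Eventually.of_forall fun V' => ?_)
  simp only [Submonoid.coe_mul, genMoment_mul, Matrix.mul_apply]

/-- A weight that is trivial on the intersection of the maximal torus with a subgroup containing
the commutators is the restriction of a character of `𝒱^G` that is trivial on the subgroup:
triviality on the commutators `torus_swap_mem` forces it to be constant on each multiplicity
space. -/
theorem exists_detChar_of_weight (hcomm : commSymUnitaries U ≤ W) (hW : W ≤ symUnitaries U)
    (hi : ∀ z, B.torus z ∈ W → ∏ x, z x ^ B.weight i x = 1) :
    ∃ q : Irreps U → ℤ, (∀ x, B.weight i x = q x.1) ∧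
      ∑ lam, q lam * (mult U lam : ℤ) = s - t ∧ ∑ lam, |q lam| * (mult U lam : ℤ) ≤ s + t ∧
      ∀ V ∈ W, B.detChar q (V : H →L[ℂ] H) = 1 := by
  have hprod : ∀ x w, ∏ y, phaseAt x w y ^ B.weight i y = w ^ B.weight i x := fun x w => by
    rw [Finset.prod_eq_single x]
    · rw [phaseAt, if_pos rfl]
    · intro y _ hy
      rw [phaseAt, if_neg hy, one_zpow]
    · simp
  have hconst : ∀ lam (j k : Fin (mult U lam)), B.weight i ⟨lam, j⟩ = B.weight i ⟨lam, k⟩ := by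
    intro lam j k
    by_contra hne
    obtain ⟨w, hw⟩ := exists_circle_zpow_ne_one (sub_ne_zero.2 hne)
    have h1 := hi _ (hcomm (B.torus_swap_mem lam j k w))
    simp only [Pi.mul_apply, mul_zpow, Finset.prod_mul_distrib, hprod] at h1
    rw [inv_zpow, ← zpow_sub] at h1
    exact hw h1
  let q : Irreps U → ℤ := fun lam => B.weight i ⟨lam, ⟨0, B.mult_pos lam⟩⟩
  have hq : ∀ x, B.weight i x = q x.1 := fun x => hconst _ _ _
  refine ⟨q, hq, ?_, ?_, fun V hV => ?_⟩
  · rw [← B.sum_weight i, Fintype.sum_sigma]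
    simp [hq, mul_comm]
  · refine le_trans (le_of_eq ?_) (B.sum_abs_weight_le i)
    rw [Fintype.sum_sigma]
    simp [hq, mul_comm]
  · obtain ⟨g, hg, z, rfl⟩ := B.exists_torus_conj (hW hV)
    have hz : B.torus z ∈ W := by
      have h1 : B.torus z = ⁅B.torus z, g⁆ * (g * B.torus z * g⁻¹) := by
        rw [commutatorElement_def]; group
      rw [h1]
      exact mul_mem (hcomm (Subgroup.commutator_mem_commutator (B.torus_mem z) hg)) hV
    have h1 := hi z hz
    rw [B.detChar_conj q (B.torus_mem z) hg, detChar_torus]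
    have h2 := congrArg (fun w : Circle => (w : ℂ)) h1
    simp only [hq, Fintype.prod_sigma, Finset.prod_zpow, Circle.coe_one] at h2
    rw [← h2, coe_circle_prod]
    refine Finset.prod_congr rfl fun lam _ => ?_
    rw [Circle.coe_zpow, coe_circle_prod]

/-- If a compact subgroup of `𝒱^G` containing the commutators has other moments than `𝒱^G`, then
this is because of a nontrivial character of `𝒱^G` of low degree that is trivial on the subgroup. -/
theorem agree_or_exists_detChar (hcomm : commSymUnitaries U ≤ W) (hW : W ≤ symUnitaries U)
    (s t : ℕ) : Agree s t (uniformDist W) (uniformDist (symUnitaries U)) ∨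
      ∃ q : Irreps U → ℤ, q ≠ 0 ∧ ∑ lam, q lam * (mult U lam : ℤ) = s - t ∧
        ∑ lam, |q lam| * (mult U lam : ℤ) ≤ s + t ∧
        ∀ V ∈ W, B.detChar q (V : H →L[ℂ] H) = 1 := by
  refine or_iff_not_imp_right.2 fun hno => (agree_iff_genMoment B.vec s t _ _).2 ?_
  set P := Matrix.of fun i j =>
    ∫ V, genMoment B.vec s t (V : H →L[ℂ] H) i j ∂uniformDist W with hP
  set PK := Matrix.of fun i j =>
    ∫ V, genMoment B.vec s t (V : H →L[ℂ] H) i j ∂uniformDist (symUnitaries U) with hPK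
  -- a row of `P` belonging to a nonzero weight vanishes, so the torus fixes `P`
  have htorus : ∀ z, genMoment B.vec s t (B.torus z : H →L[ℂ] H) * P = P := by
    intro z
    ext i j
    rw [genMoment_torus_mul]
    by_cases hij : P i j = 0
    · rw [hij, mul_zero]
    · have hi : ∀ z, B.torus z ∈ W → ∏ x, z x ^ B.weight i x = 1 := fun z hz => by
        have h1 := congrFun (congrFun (genMoment_mul_average (s := s) (t := t) B.vec hz) i) j
        rw [← hP, genMoment_torus_mul] at h1
        exact Circle.ext ((mul_eq_right₀ hij).1 h1)
      obtain ⟨q, hq, h1, h2, h3⟩ := B.exists_detChar_of_weight i hcomm hW hi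
      have hq0 : q = 0 := by
        by_contra hq0
        exact hno ⟨q, hq0, h1, h2, h3⟩
      simp [hq, hq0]
  -- every invariant unitary is the product of an element of the torus and a commutator
  have hK : ∀ V ∈ symUnitaries U, genMoment B.vec s t (V : H →L[ℂ] H) * P = P := by
    intro V hV
    obtain ⟨g, hg, z, rfl⟩ := B.exists_torus_conj hV
    have h1 : g * B.torus z * g⁻¹ = B.torus z * ⁅(B.torus z)⁻¹, g⁆ := by
      rw [commutatorElement_def]; group
    rw [h1, Submonoid.coe_mul, genMoment_mul, mul_assoc, genMoment_mul_average B.vec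
      (hcomm (Subgroup.commutator_mem_commutator (inv_mem (B.torus_mem z)) hg)), htorus]
  -- the product of the two averages is equal to both of them
  have h1 : PK * P = P := by
    ext i j
    rw [Matrix.mul_apply]
    refine (sum_integral_mul _ _ fun k => continuous_genMoment B.vec s t i k).trans ?_
    rw [integral_uniformDist_congr (f' := fun _ => P i j) ?_ continuous_const]
    · simp
    · intro V hV
      rw [← Matrix.mul_apply, hK V hV]
    · exact continuous_finsetSum _ fun k _ =>
        (continuous_genMoment B.vec s t i k).mul continuous_const
  have h2 : PK * P = PK := by
    ext i j
    have h3 : ∀ V ∈ W, ∑ k, PK i k * genMoment B.vec s t (V : H →L[ℂ] H) k j = PK i j := by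
      intro V hV
      refine (sum_integral_mul _ _ fun k => continuous_genMoment B.vec s t i k).trans ?_
      rw [hPK, Matrix.of_apply,
        ← integral_uniformDist_mul_right (continuous_genMoment B.vec s t i j) (hW hV)]
      refine integral_congr_ae (Filter.Eventually.of_forall fun V' => ?_)
      simp only [Submonoid.coe_mul, genMoment_mul, Matrix.mul_apply]
    rw [Matrix.mul_apply]
    refine (sum_mul_integral _ _ fun k => continuous_genMoment B.vec s t k j).trans ?_
    rw [integral_uniformDist_congr (f' := fun _ => PK i j) ?_ continuous_const h3]
    · simp
    · exact continuous_finsetSum _ fun k _ =>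
        continuous_const.mul (continuous_genMoment B.vec s t k j)
  intro i j
  exact congrFun (congrFun (h1.symm.trans h2) i) j

end AdaptedBasis

/-! ### The operator `Q` -/

section Operators
variable {G : Type*} [Group G]
variable {H : Type*} [NormedAddCommGroup H] [InnerProductSpace ℂ H] [FiniteDimensional ℂ H]
  [CompleteSpace H]
variable {U : G →* unitary (H →L[ℂ] H)}

theorem opTrace_sum_smul {α : Type*} (S : Finset α) (c : α → ℂ) (A : α → H →L[ℂ] H) :
    opTrace (∑ x ∈ S, c x • A x) = ∑ x ∈ S, c x * opTrace (A x) := by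
  simp [opTrace, ContinuousLinearMap.toLinearMap_sum]

namespace AdaptedBasis

theorem sum_smul_proj_vec (B : AdaptedBasis U) (c : Irreps U → ℂ) (x) :
    (∑ lam, c lam • proj U lam) (B.vec x) = c x.1 • B.vec x := by
  rw [sum_apply, Finset.sum_eq_single x.1]
  · rw [smul_apply, B.proj_vec, if_pos rfl]
  · intro mu _ hmu
    rw [smul_apply, B.proj_vec, if_neg (Ne.symm hmu), smul_zero]
  · simp

theorem sum_smul_proj_mul (B : AdaptedBasis U) (c c' : Irreps U → ℂ) :
    (∑ lam, c lam • proj U lam) * (∑ lam, c' lam • proj U lam) =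
      ∑ lam, (c lam * c' lam) • proj U lam := by
  refine B.ext_vec fun x => ?_
  rw [mul_apply_eq_comp, B.sum_smul_proj_vec, map_smul, B.sum_smul_proj_vec, B.sum_smul_proj_vec,
    smul_smul, mul_comm]

theorem star_sum_smul_proj (c : Irreps U → ℂ) :
    star (∑ lam, c lam • proj U lam) = ∑ lam, star (c lam) • proj U lam := by
  rw [star_sum]
  refine Finset.sum_congr rfl fun lam _ => ?_
  have h : IsSelfAdjoint (proj U lam) := isSelfAdjoint_starProjection (sector U lam)
  rw [star_smul, h.star_eq]

theorem opTrace_proj_ne_zero (B : AdaptedBasis U) (lam : Irreps U) : opTrace (proj U lam) ≠ 0 := by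
  rw [B.opTrace_proj]
  have h1 := B.dim_pos lam
  have h2 := B.mult_pos lam
  exact mul_ne_zero (by exact_mod_cast h1.ne') (by exact_mod_cast h2.ne')

theorem opTrace_opQ (B : AdaptedBasis U) (q : Irreps U → ℤ) :
    opTrace (opQ U q) = ∑ lam, (q lam : ℂ) * (mult U lam : ℂ) := by
  rw [opQ, opTrace_sum_smul]
  refine Finset.sum_congr rfl fun lam _ => ?_
  rw [div_mul_cancel₀ _ (B.opTrace_proj_ne_zero lam)]

theorem opTrace_mul_opQ (q : Irreps U → ℤ) (A : H →L[ℂ] H) :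
    opTrace (A * opQ U q) = ∑ lam, (q lam : ℂ) * (mult U lam : ℂ) *
      (opTrace (A * proj U lam) / opTrace (proj U lam)) := by
  rw [opQ, Finset.mul_sum]
  simp only [mul_smul_comm]
  rw [opTrace_sum_smul]
  refine Finset.sum_congr rfl fun lam _ => ?_
  ring

theorem mult_mul_opTrace_div (B : AdaptedBasis U) {A : H →L[ℂ] H} (hA : IsInvariant U A)
    (lam : Irreps U) :
    (mult U lam : ℂ) * (opTrace (A * proj U lam) / opTrace (proj U lam)) =
      (B.block lam A).trace := by
  have h1 : (B.dim lam : ℂ) ≠ 0 := by exact_mod_cast (B.dim_pos lam).ne'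
  have h2 : (mult U lam : ℂ) ≠ 0 := by exact_mod_cast (B.mult_pos lam).ne'
  rw [B.opTrace_mul_proj lam hA, B.opTrace_proj]
  field_simp

/-- The positive square root of `Q Q†` is `∑_λ |q(λ)| m_λ Π_λ / Tr Π_λ`. -/
theorem traceNorm_opQ (B : AdaptedBasis U) (q : Irreps U → ℤ) :
    traceNorm (opQ U q) = ∑ lam, |(q lam : ℝ)| * (mult U lam : ℝ) := by
  let c : Irreps U → ℝ := fun lam => |(q lam : ℝ)| / B.dim lam
  have hc : ∀ lam, 0 ≤ c lam := fun lam => by positivity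
  have hQ : opQ U q = ∑ lam, ((q lam / B.dim lam : ℝ) : ℂ) • proj U lam := by
    rw [opQ]
    refine Finset.sum_congr rfl fun lam _ => ?_
    have h1 : (B.dim lam : ℂ) ≠ 0 := by exact_mod_cast (B.dim_pos lam).ne'
    have h2 : (mult U lam : ℂ) ≠ 0 := by exact_mod_cast (B.mult_pos lam).ne'
    rw [B.opTrace_proj]
    congr 1
    push_cast
    field_simp
  have hsq : (∑ lam, (c lam : ℂ) • proj U lam) * (∑ lam, (c lam : ℂ) • proj U lam) =
      opQ U q * star (opQ U q) := by
    rw [hQ, star_sum_smul_proj, B.sum_smul_proj_mul, B.sum_smul_proj_mul]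
    refine Finset.sum_congr rfl fun lam _ => ?_
    congr 1
    rw [Complex.star_def, Complex.conj_ofReal, ← Complex.ofReal_mul, ← Complex.ofReal_mul]
    congr 1
    rw [← pow_two, ← pow_two, div_pow, sq_abs, div_pow]
  have hpos : 0 ≤ ∑ lam, (c lam : ℂ) • proj U lam := by
    have h1 : (∑ lam, (c lam : ℂ) • proj U lam) =
        star (∑ lam, ((√(c lam) : ℝ) : ℂ) • proj U lam) *
          ∑ lam, ((√(c lam) : ℝ) : ℂ) • proj U lam := by
      rw [star_sum_smul_proj, B.sum_smul_proj_mul]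
      refine Finset.sum_congr rfl fun lam _ => ?_
      rw [Complex.star_def, Complex.conj_ofReal, ← Complex.ofReal_mul, Real.mul_self_sqrt (hc lam)]
    rw [h1]
    exact star_mul_self_nonneg _
  rw [traceNorm, CFC.sqrt_unique hsq hpos, opTrace_sum_smul, Complex.re_sum]
  refine Finset.sum_congr rfl fun lam _ => ?_
  have h1 : (B.dim lam : ℝ) ≠ 0 := by exact_mod_cast (B.dim_pos lam).ne'
  have h2 : (c lam : ℂ) * opTrace (proj U lam) = ((|(q lam : ℝ)| * mult U lam : ℝ) : ℂ) := by
    rw [B.opTrace_proj]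
    have h3 : |(q lam : ℝ)| * mult U lam = c lam * (B.dim lam * mult U lam) := by
      simp only [c]
      field_simp
    rw [h3]
    push_cast
    ring
  rw [h2, Complex.ofReal_re]

/-- In terms of characters: `q` is admissible if and only if the character `∏_λ (det V_λ)^{q(λ)}` is
nontrivial, but its differential vanishes on `1` and on the Hamiltonians. -/
theorem admissible_iff (B : AdaptedBasis U) {ι : Type*} {Ham : ι → H →L[ℂ] H}
    (hinv : ∀ l, IsInvariant U (Ham l)) (q : Irreps U → ℤ) :
    Admissible U Ham q ↔ q ≠ 0 ∧ ∑ lam, q lam * (mult U lam : ℤ) = 0 ∧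
      ∀ l, ∑ lam, q lam * (B.block lam (Ham l)).trace = 0 := by
  rw [Admissible, B.traceNorm_opQ, B.opTrace_opQ]
  refine and_congr (not_congr ?_) (and_congr ?_ (forall_congr' fun l => ?_))
  · rw [Finset.sum_eq_zero_iff_of_nonneg fun lam _ => by positivity]
    constructor
    · intro h
      funext lam
      have h1 : (mult U lam : ℝ) ≠ 0 := by exact_mod_cast (B.mult_pos lam).ne'
      simpa [h1] using h lam (Finset.mem_univ lam)
    · rintro rfl lam _
      simp
  · constructor
    · intro h
      exact_mod_cast h
    · intro h
      exact_mod_cast h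
  · rw [opTrace_mul_opQ]
    simp only [mul_assoc, B.mult_mul_opTrace_div (hinv l)]

end AdaptedBasis
end Operators

/-! ### Polynomials determine measures on the unitary group -/

section Uniqueness
open BoundedContinuousFunction
variable {H : Type*} [NormedAddCommGroup H] [InnerProductSpace ℂ H] [FiniteDimensional ℂ H]
  [CompleteSpace H]

/-- The polynomial functions on the unitary group. -/
def allPolys (H : Type*) [NormedAddCommGroup H] [InnerProductSpace ℂ H] [FiniteDimensional ℂ H]
    [CompleteSpace H] : Submodule ℂ (unitary (H →L[ℂ] H) → ℂ) :=
  ⨆ st : ℕ × ℕ, polys H st.1 st.2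

theorem polys_le_allPolys (s t : ℕ) : polys H s t ≤ allPolys H :=
  le_iSup (fun st : ℕ × ℕ => polys H st.1 st.2) (s, t)

theorem mul_mem_allPolys {f f' : unitary (H →L[ℂ] H) → ℂ} (hf : f ∈ allPolys H)
    (hf' : f' ∈ allPolys H) : f * f' ∈ allPolys H := by
  have h : allPolys H * allPolys H ≤ allPolys H := by
    rw [allPolys, Submodule.iSup_mul]
    refine iSup_le fun st => ?_
    rw [Submodule.mul_iSup]
    refine iSup_le fun st' => Submodule.mul_le.2 fun g hg g' hg' => ?_
    exact polys_le_allPolys _ _ (polys_mul_mem hg hg')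
  exact h (Submodule.mul_mem_mul hf hf')

theorem star_mem_allPolys {f : unitary (H →L[ℂ] H) → ℂ} (hf : f ∈ allPolys H) :
    star f ∈ allPolys H := by
  refine Submodule.iSup_induction (fun st : ℕ × ℕ => polys H st.1 st.2)
    (motive := fun f => star f ∈ allPolys H) hf
    (fun st f hf => polys_le_allPolys _ _ (star_mem_polys hf)) ?_ ?_
  · rw [star_zero]; exact zero_mem _
  · intro f f' hf hf'
    rw [star_add]; exact add_mem hf hf'

/-- The polynomial functions on the unitary group, as an algebra of bounded continuous functions. -/
def polyAlgebra (H : Type*) [NormedAddCommGroup H] [InnerProductSpace ℂ H] [FiniteDimensional ℂ H]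
    [CompleteSpace H] : StarSubalgebra ℂ (unitary (H →L[ℂ] H) →ᵇ ℂ) where
  carrier := {f | ⇑f ∈ allPolys H}
  mul_mem' hf hf' := mul_mem_allPolys hf hf'
  add_mem' hf hf' := (allPolys H).add_mem hf hf'
  algebraMap_mem' c := by
    have h : (algebraMap ℂ (unitary (H →L[ℂ] H) →ᵇ ℂ) c : unitary (H →L[ℂ] H) → ℂ) =
        c • (1 : unitary (H →L[ℂ] H) → ℂ) := by
      funext V
      simp [Algebra.algebraMap_eq_smul_one]
    change _ ∈ allPolys H
    rw [h]
    exact Submodule.smul_mem _ _ (polys_le_allPolys _ _ one_mem_polys_zero)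
  star_mem' hf := star_mem_allPolys hf

theorem mem_polyAlgebra {f : unitary (H →L[ℂ] H) →ᵇ ℂ} :
    f ∈ polyAlgebra H ↔ ⇑f ∈ allPolys H := Iff.rfl

/-- By the Stone–Weierstrass theorem, a measure on the unitary group is determined by the integrals
of the polynomials. -/
theorem measure_eq_of_agree {μ ν : Measure (unitary (H →L[ℂ] H))} [IsFiniteMeasure μ]
    [IsFiniteMeasure ν] (h : ∀ s t, Agree s t μ ν) : μ = ν := by
  have : ProperSpace (H →L[ℂ] H) := FiniteDimensional.proper ℂ _
  refine ext_of_forall_mem_subalgebra_integral_eq_of_pseudoEMetric_complete_countable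
    (𝕜 := ℂ) (A := polyAlgebra H) ?_ ?_
  · intro V W hVW
    let b := stdOrthonormalBasis ℂ H
    obtain ⟨ij, hij⟩ : ∃ ij, entry b ij V ≠ entry b ij W := by
      by_contra! hcon
      refine hVW (Subtype.ext (ContinuousLinearMap.coe_injective
        ((LinearMap.toMatrix b.toBasis b.toBasis).injective ?_)))
      ext i j
      exact hcon (i, j)
    have hmem : entry b ij ∈ linForms H := by
      rw [linForms_eq_span b]; exact Submodule.subset_span ⟨ij, rfl⟩
    let f := BoundedContinuousFunction.mkOfCompact ⟨entry b ij, continuous_entry b ij⟩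
    have hf : f ∈ polyAlgebra H :=
      mem_polyAlgebra.2 (polys_le_allPolys _ _ (linForms_le_polys hmem))
    exact ⟨_, ⟨_, ⟨f, hf, rfl⟩, rfl⟩, hij⟩
  · intro g hg
    have hg' := mem_polyAlgebra.1 hg
    have : Continuous ⇑g ∧ ∫ V, g V ∂μ = ∫ V, g V ∂ν := by
      refine Submodule.iSup_induction (fun st : ℕ × ℕ => polys H st.1 st.2)
        (motive := fun f => Continuous f ∧ ∫ V, f V ∂μ = ∫ V, f V ∂ν) hg'
        (fun st f hf => ⟨continuous_of_mem_polys hf, h _ _ f hf⟩) ⟨continuous_const, by simp⟩ ?_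
      rintro f f' ⟨hf1, hf2⟩ ⟨hf1', hf2'⟩
      refine ⟨hf1.add hf1', ?_⟩
      simp only [Pi.add_apply]
      rw [integral_add (integrable_of_continuous hf1 _) (integrable_of_continuous hf1' _),
        integral_add (integrable_of_continuous hf1 _) (integrable_of_continuous hf1' _), hf2, hf2']
    exact this.2

end Uniqueness

/-! ### Global phases -/

section Phases
variable {H : Type*} [NormedAddCommGroup H] [InnerProductSpace ℂ H] [FiniteDimensional ℂ H]
  [CompleteSpace H]

/-- The global phases, as unitary operators. -/
def phaseHom (H : Type*) [NormedAddCommGroup H] [InnerProductSpace ℂ H] [FiniteDimensional ℂ H]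
    [CompleteSpace H] : Circle →* unitary (H →L[ℂ] H) where
  toFun w := ⟨(w : ℂ) • 1, by
    have h : (w : ℂ) * star (w : ℂ) = 1 := by
      rw [Complex.star_def, Complex.mul_conj, Circle.normSq_coe, Complex.ofReal_one]
    refine Unitary.mem_iff.2 ⟨?_, ?_⟩
    · rw [star_smul, star_one, smul_mul_smul_comm, one_mul, mul_comm, h, one_smul]
    · rw [star_smul, star_one, smul_mul_smul_comm, one_mul, h, one_smul]⟩
  map_one' := Subtype.ext (by simp)
  map_mul' w w' := Subtype.ext (by simp [smul_smul, mul_comm])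

theorem coe_phaseHom (w : Circle) : (phaseHom H w : H →L[ℂ] H) = (w : ℂ) • 1 := rfl

theorem phaseHom_mul_comm (w : Circle) (V : unitary (H →L[ℂ] H)) :
    phaseHom H w * V = V * phaseHom H w :=
  Subtype.ext (by simp [coe_phaseHom])

instance normal_range_phaseHom : (phaseHom H).range.Normal := by
  refine ⟨?_⟩
  rintro _ ⟨w, rfl⟩ V
  exact ⟨w, by rw [← phaseHom_mul_comm, mul_inv_cancel_right]⟩

instance compactSpace_sup_phases (W : Subgroup (unitary (H →L[ℂ] H))) [CompactSpace W] :
    CompactSpace (W ⊔ (phaseHom H).range : Subgroup (unitary (H →L[ℂ] H))) := by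
  refine isCompact_iff_compactSpace
    (s := ((W ⊔ (phaseHom H).range : Subgroup _) : Set (unitary (H →L[ℂ] H)))).mp ?_
  rw [Subgroup.mul_normal, MonoidHom.coe_range]
  refine IsCompact.mul (isCompact_iff_compactSpace.2 inferInstance) (isCompact_range ?_)
  exact Continuous.subtype_mk (by fun_prop) _

end Phases

namespace AdaptedBasis
variable {G : Type*} [Group G]
variable {H : Type*} [NormedAddCommGroup H] [InnerProductSpace ℂ H] [FiniteDimensional ℂ H]
  [CompleteSpace H]
variable {U : G →* unitary (H →L[ℂ] H)} (B : AdaptedBasis U)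

theorem range_phaseHom_le : (phaseHom H).range ≤ symUnitaries U := by
  rintro _ ⟨w, rfl⟩
  refine mem_symUnitaries_of_isInvariant fun g => ?_
  rw [coe_phaseHom]
  exact (Commute.one_left _).smul_left _

/-- On the global phases, a character is a power whose exponent is `Tr Q`. -/
theorem detChar_phaseHom (q : Irreps U → ℤ) (w : Circle) :
    B.detChar q (phaseHom H w : H →L[ℂ] H) =
      ((w ^ ∑ lam, q lam * (mult U lam : ℤ) : Circle) : ℂ) := by
  have hw : (w : ℂ) ≠ 0 := Circle.coe_ne_zero w
  rw [Circle.coe_zpow]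
  have h : ∀ S : Finset (Irreps U), ∏ lam ∈ S, (B.block lam (phaseHom H w)).det ^ q lam =
      (w : ℂ) ^ ∑ lam ∈ S, q lam * (mult U lam : ℤ) := by
    intro S
    induction S using Finset.induction_on with
    | empty => simp
    | insert a S ha ih =>
      rw [Finset.prod_insert ha, Finset.sum_insert ha, ih, zpow_add₀ hw, coe_phaseHom, block_smul,
        block_one, Matrix.det_smul, Matrix.det_one, mul_one, Fintype.card_fin, ← zpow_natCast,
        ← zpow_mul, mul_comm (q a)]
  exact h _

variable {ι : Type*} {Ham : ι → H →L[ℂ] H}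

/-! ### Designs and admissible `q` -/

/-- The uniform distribution over the generated group is a `t`-design if and only if `2 t < ‖Q‖₁`
for all admissible `q`. -/
theorem isTDesign_iff (B : AdaptedBasis U) {κ : Type*} [Fintype κ] [DecidableEq κ]
    (b : OrthonormalBasis κ ℂ H)
    (hsa : ∀ l, IsSelfAdjoint (Ham l)) (hinv : ∀ l, IsInvariant U (Ham l))
    [CompactSpace (generatedGroup Ham)] (hsemi : commSymUnitaries U ≤ generatedGroup Ham) (t : ℕ) :
    IsTDesign b t (uniformDist (generatedGroup Ham)) (uniformDist (symUnitaries U)) ↔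
      ∀ q, Admissible U Ham q → 2 * (t : ℤ) < ∑ lam, |q lam| * (mult U lam : ℤ) := by
  have hle := generatedGroup_le hinv
  rw [isTDesign_iff_agree]
  constructor
  · intro h q hq
    obtain ⟨h1, h2, h3⟩ := (B.admissible_iff hinv q).1 hq
    by_contra! hlt
    exact B.not_agree_of_detChar hle h1
      ((B.detChar_generatedGroup_iff hinv hsa q).2 h3) h2 hlt h
  · intro h
    refine (B.agree_or_exists_detChar hsemi hle t t).resolve_right ?_
    rintro ⟨q, h1, h2, h3, h4⟩
    have := h q ((B.admissible_iff hinv q).2 ⟨h1, by simpa using h2,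
      (B.detChar_generatedGroup_iff hinv hsa q).1 h4⟩)
    omega

/-- Without admissible `q`, adjoining the global phases to the generated group gives a group with
the same averages of all polynomials as `𝒱^G`, which is therefore `𝒱^G`. -/
theorem symUnitaries_le_sup_phases (B : AdaptedBasis U) (hsa : ∀ l, IsSelfAdjoint (Ham l))
    (hinv : ∀ l, IsInvariant U (Ham l)) [CompactSpace (generatedGroup Ham)]
    (hsemi : commSymUnitaries U ≤ generatedGroup Ham) (hno : ¬ ∃ q, Admissible U Ham q) :
    symUnitaries U ≤ generatedGroup Ham ⊔ (phaseHom H).range := by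
  refine le_of_uniformDist_eq (measure_eq_of_agree fun s t => ?_).symm
  refine (B.agree_or_exists_detChar (hsemi.trans le_sup_left)
    (sup_le (generatedGroup_le hinv) range_phaseHom_le) s t).resolve_right ?_
  rintro ⟨q, h1, -, -, h4⟩
  refine hno ⟨q, (B.admissible_iff hinv q).2 ⟨h1, ?_,
    (B.detChar_generatedGroup_iff hinv hsa q).1 fun V hV => h4 V (Subgroup.mem_sup_left hV)⟩⟩
  by_contra h0
  obtain ⟨w, hw⟩ := exists_circle_zpow_ne_one h0
  have h5 := h4 (phaseHom H w) (Subgroup.mem_sup_right ⟨w, rfl⟩)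
  rw [detChar_phaseHom] at h5
  exact hw (Circle.ext h5)

/-- The minimum `N` of `‖Q‖₁` over the admissible `q` is an even positive integer, and `2 t < N`
means `t ≤ N / 2 - 1`. -/
theorem tMax_eq_of_exists_admissible (B : AdaptedBasis U) {κ : Type*} [Fintype κ] [DecidableEq κ]
    (b : OrthonormalBasis κ ℂ H)
    (hsa : ∀ l, IsSelfAdjoint (Ham l)) (hinv : ∀ l, IsInvariant U (Ham l))
    [CompactSpace (generatedGroup Ham)] (hsemi : commSymUnitaries U ≤ generatedGroup Ham)
    (hex : ∃ q, Admissible U Ham q) :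
    ∃ (N : ℝ) (t : ℕ),
      IsLeast {r : ℝ | ∃ q, Admissible U Ham q ∧ r = traceNorm (opQ U q)} N ∧
      IsLeast {r : ℝ | ∃ q, Admissible U Ham q ∧
        r = ∑ lam, |(q lam : ℝ)| * (mult U lam : ℝ)} N ∧
      tMax b (uniformDist (generatedGroup Ham)) (uniformDist (symUnitaries U)) = (t : ℕ∞) ∧
      (t : ℝ) = 1 / 2 * N - 1 := by
  have hdesign := B.isTDesign_iff b hsa hinv hsemi
  have hset : {r : ℝ | ∃ q, Admissible U Ham q ∧ r = traceNorm (opQ U q)} =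
      {r : ℝ | ∃ q, Admissible U Ham q ∧ r = ∑ lam, |(q lam : ℝ)| * (mult U lam : ℝ)} := by
    simp only [B.traceNorm_opQ]
  -- a minimizer exists, since the values of the norm are natural numbers
  obtain ⟨q, hq, hmin⟩ : ∃ q, Admissible U Ham q ∧ ∀ q', Admissible U Ham q' →
      ∑ lam, |q lam| * (mult U lam : ℤ) ≤ ∑ lam, |q' lam| * (mult U lam : ℤ) := by
    have hnn : ∀ q : Irreps U → ℤ, 0 ≤ ∑ lam, |q lam| * (mult U lam : ℤ) := fun q =>
      Finset.sum_nonneg fun lam _ => by positivity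
    obtain ⟨q, hq, hmin⟩ := exists_minimalFor_of_wellFoundedLT (Admissible U Ham)
      (fun q => (∑ lam, |q lam| * (mult U lam : ℤ)).toNat) hex
    refine ⟨q, hq, fun q' hq' => ?_⟩
    have h1 := hnn q
    have h2 := hnn q'
    rcases le_total (∑ lam, |q lam| * (mult U lam : ℤ)).toNat
      (∑ lam, |q' lam| * (mult U lam : ℤ)).toNat with h | h
    · omega
    · have := hmin hq' h
      dsimp only at this
      omega
  obtain ⟨h1, h2, -⟩ := (B.admissible_iff hinv q).1 hq
  set n := ∑ lam, |q lam| * (mult U lam : ℤ) with hn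
  -- the minimum is even, because the positive and the negative part of `q` balance
  have heven : Even n := by
    have h3 : Even (n - ∑ lam, q lam * (mult U lam : ℤ)) := by
      rw [hn, ← Finset.sum_sub_distrib]
      refine Finset.even_sum _ fun lam _ => ?_
      rw [← sub_mul]
      refine Even.mul_right ?_ _
      rcases abs_cases (q lam) with h | h
      · simp [h.1]
      · rw [h.1]; exact ⟨-q lam, by ring⟩
    rwa [h2, sub_zero] at h3
  have hpos : 0 < n := by
    obtain ⟨lam, hlam⟩ := Function.ne_iff.1 h1
    refine Finset.sum_pos' (fun lam _ => by positivity) ⟨lam, Finset.mem_univ _, ?_⟩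
    have := B.mult_pos lam
    have h3 : (0 : ℤ) < |q lam| := abs_pos.2 hlam
    positivity
  obtain ⟨k, hk⟩ := heven
  have hleast : IsLeast {r : ℝ | ∃ q, Admissible U Ham q ∧
      r = ∑ lam, |(q lam : ℝ)| * (mult U lam : ℝ)} (n : ℝ) := by
    refine ⟨⟨q, hq, by rw [hn]; push_cast; rfl⟩, ?_⟩
    rintro _ ⟨q', hq', rfl⟩
    have := hmin q' hq'
    exact_mod_cast this
  refine ⟨n, (k - 1).toNat, hset ▸ hleast, hleast, ?_, ?_⟩
  · have hiff : ∀ t : ℕ, IsTDesign b t (uniformDist (generatedGroup Ham))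
        (uniformDist (symUnitaries U)) ↔ t ≤ (k - 1).toNat := fun t => by
      rw [hdesign]
      constructor
      · intro h
        have := h q hq
        omega
      · intro h q' hq'
        have := hmin q' hq'
        omega
    rw [tMax]
    refine le_antisymm (iSup₂_le fun t ht => ?_) ?_
    · exact_mod_cast (hiff t).1 ht
    · exact le_iSup₂_of_le (k - 1).toNat ((hiff _).2 le_rfl) le_rfl
  · have h3 : (((k - 1).toNat : ℤ) : ℝ) = ((k - 1 : ℤ) : ℝ) := by
      rw [Int.toNat_of_nonneg (by omega)]
    have h4 : (n : ℝ) = k + k := by exact_mod_cast hk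
    push_cast at h3
    rw [h3, h4]
    ring

theorem exists_phase_smul_mem (B : AdaptedBasis U)
    (hsa : ∀ l, IsSelfAdjoint (Ham l)) (hinv : ∀ l, IsInvariant U (Ham l))
    [CompactSpace (generatedGroup Ham)] (hsemi : commSymUnitaries U ≤ generatedGroup Ham)
    (hno : ¬ ∃ q, Admissible U Ham q) {V : unitary (H →L[ℂ] H)} (hV : V ∈ symUnitaries U) :
    ∃ θ : ℝ, ∃ W ∈ generatedGroup Ham,
      (W : H →L[ℂ] H) = Complex.exp (Complex.I * (θ : ℂ)) • (V : H →L[ℂ] H) := by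
  obtain ⟨W, hW, Z, ⟨w, rfl⟩, hWZ⟩ :=
    Subgroup.mem_sup_of_normal_right.1 (B.symUnitaries_le_sup_phases hsa hinv hsemi hno hV)
  obtain ⟨θ, hθ⟩ := Circle.exp_surjective w⁻¹
  refine ⟨θ, W, hW, ?_⟩
  have h1 : W = phaseHom H w⁻¹ * V := by
    rw [phaseHom_mul_comm, ← hWZ, map_inv, mul_inv_cancel_right]
  rw [h1, ← hθ, Submonoid.coe_mul, coe_phaseHom, Circle.coe_exp, smul_mul_assoc, one_mul,
    mul_comm]

theorem tMax_eq_top (B : AdaptedBasis U) {κ : Type*} [Fintype κ] [DecidableEq κ]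
    (b : OrthonormalBasis κ ℂ H)
    (hsa : ∀ l, IsSelfAdjoint (Ham l)) (hinv : ∀ l, IsInvariant U (Ham l))
    [CompactSpace (generatedGroup Ham)] (hsemi : commSymUnitaries U ≤ generatedGroup Ham)
    (hno : ¬ ∃ q, Admissible U Ham q) :
    tMax b (uniformDist (generatedGroup Ham)) (uniformDist (symUnitaries U)) = ⊤ := by
  rw [tMax, ENat.eq_top_iff_forall_ge]
  intro t
  exact le_iSup₂_of_le t ((B.isTDesign_iff b hsa hinv hsemi t).2
    fun q hq => (hno ⟨q, hq⟩).elim) le_rfl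

end AdaptedBasis

end SymDesign

end

theorem mainTheorem1
    {H : Type*} [NormedAddCommGroup H] [InnerProductSpace ℂ H] [FiniteDimensional ℂ H]
    [CompleteSpace H]
    {κ : Type*} [Fintype κ] [DecidableEq κ] (b : OrthonormalBasis κ ℂ H)
    {G : Type*} [Group G] [TopologicalSpace G] [IsTopologicalGroup G] [CompactSpace G]
    (U : G →* unitary (H →L[ℂ] H)) (hU : Continuous U)
    {ι : Type*} (Ham : ι → H →L[ℂ] H)
    (hsa : ∀ l, IsSelfAdjoint (Ham l))
    (hinv : ∀ l g, Commute (Ham l) (U g : H →L[ℂ] H))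
    [CompactSpace (SymDesign.generatedGroup Ham)]
    (hsemi : SymDesign.commSymUnitaries U ≤ SymDesign.generatedGroup Ham) :
    (∀ q : SymDesign.Irreps U → ℤ,
      SymDesign.traceNorm (SymDesign.opQ U q) = ∑ lam, |(q lam : ℝ)| * (SymDesign.mult U lam : ℝ) ∧
      SymDesign.opTrace (SymDesign.opQ U q) = ∑ lam, (q lam : ℂ) * (SymDesign.mult U lam : ℂ) ∧
      ∀ l, SymDesign.opTrace (Ham l * SymDesign.opQ U q) =
        ∑ lam, (q lam : ℂ) * (SymDesign.mult U lam : ℂ) *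
          (SymDesign.opTrace (Ham l * SymDesign.proj U lam) /
            SymDesign.opTrace (SymDesign.proj U lam))) ∧
    ((∃ q, SymDesign.Admissible U Ham q) →
      ∃ (N : ℝ) (t : ℕ),
        IsLeast {r : ℝ | ∃ q, SymDesign.Admissible U Ham q ∧
          r = SymDesign.traceNorm (SymDesign.opQ U q)} N ∧
        IsLeast {r : ℝ | ∃ q, SymDesign.Admissible U Ham q ∧
          r = ∑ lam, |(q lam : ℝ)| * (SymDesign.mult U lam : ℝ)} N ∧
        SymDesign.tMax b (SymDesign.uniformDist (SymDesign.generatedGroup Ham))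
          (SymDesign.uniformDist (SymDesign.symUnitaries U)) = (t : ℕ∞) ∧
        (t : ℝ) = 1 / 2 * N - 1) ∧
    ((¬ ∃ q, SymDesign.Admissible U Ham q) →
      (∀ V ∈ SymDesign.symUnitaries U, ∃ θ : ℝ, ∃ W ∈ SymDesign.generatedGroup Ham,
        (W : H →L[ℂ] H) = Complex.exp (Complex.I * (θ : ℂ)) • (V : H →L[ℂ] H)) ∧
      SymDesign.tMax b (SymDesign.uniformDist (SymDesign.generatedGroup Ham))
        (SymDesign.uniformDist (SymDesign.symUnitaries U)) = ⊤) := by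
  obtain ⟨B⟩ := SymDesign.nonempty_adaptedBasis U
  exact ⟨fun q => ⟨B.traceNorm_opQ q, B.opTrace_opQ q,
    fun l => SymDesign.AdaptedBasis.opTrace_mul_opQ q (Ham l)⟩,
    B.tMax_eq_of_exists_admissible b hsa hinv hsemi,
    fun hno => ⟨fun _ hV => B.exists_phase_smul_mem hsa hinv hsemi hno hV,
      B.tMax_eq_top b hsa hinv hsemi hno⟩⟩
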